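/- Conventions. For a Kähler manifold with Riemannian metric $g$ and complex structure $J$ the Kähler form is $\omega(u,v)=g(Ju,v)$, and a Kähler potential is a function $\Phi$ with $\omega=\frac i2\partial\bar\partial\Phi$. Let $(Y,g)$ be a compact connected real analytic Kähler manifold of complex dimension $n\ge 0$ with universal Kähler covering $(\tilde Y,\tilde g)$, and write $\nu_{\tilde g}$ for the Riemannian volume and $\tilde\rho$ for the geodesic distance of $\tilde g$. We say that $(Y,g)$ (or $(\tilde Y,\tilde g)$) has *globally defined diastasis* if there is a real analytic function $\mathcal D:\tilde Y\times\tilde Y\to\mathbb R$ which near each point of the diagonal is Calabi's diastasis $$\mathcal D(z,w)=\hat\Phi(z,\bar z)+\hat\Phi(w,\bar w)-\hat\Phi(z,\bar w)-\hat\Phi(w,\bar z),$$ where $\Phi$ is a real analytic local Kähler potential and $\hat\Phi(z,\bar w)$ is its extension that is holomorphic in $z$, antiholomorphic in $w$, and equal to $\Phi$ on the diagonal. Put $\mathcal D_w(x)=\mathcal D(x,w)$ and $\mathcal X(\tilde g)=\sup_{y,z\in\tilde Y}\|\operatorname{grad}_y\mathcal D_z\|\in[0,\infty]$. For a base point $w\in\tilde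 Y$ define $$\operatorname{Ent_d}(Y,g)=\operatorname{Ent_d}(\tilde Y,\tilde g)=\mathcal X(\tilde g)\,\inf\Big\{c>0:\int_{\tilde Y}e^{-c\,\mathcal D_w}\,\nu_{\tilde g}<\infty\Big\},$$ which is set equal to $\infty$ if $\mathcal X(\tilde g)=\infty$ or if there is no such $c$, and $$\operatorname{Ent_v}(Y,g)=\operatorname{Ent_v}(\tilde Y,\tilde g)=\inf\Big\{c>0:\int_{\tilde Y}e^{-c\,\tilde\rho(w,x)}\,\nu_{\tilde g}(x)<\infty\Big\}.$$ Lemma. (1) If $(Y,g)$ is a compact connected Kähler manifold with globally defined diastasis, then, for every choice of the base points, $$\operatorname{Ent_d}(Y,g)\ \ge\ \operatorname{Ent_v}(Y,g).$$ (2) Let $\mathbb CH^n=\{z\in\mathbb C^n:\|z\|<1\}$ carry the hyperbolic metric $g_h$ of constant holomorphic sectional curvature $-4$, that is, the metric with Kähler form $-\frac i2\partial\bar\partial\log(1-\|z\|^2)$. Then $$\mathcal D^h(w,z)=-\log\frac{(1-\|z\|^2)(1-\|w\|^2)}{|1-\langle z,w\rangle|^2}$$ is a globally defined diastasis of $(\mathbb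 CH^n,g_h)$ and, for every choice of the base points, $$\operatorname{Ent_d}(\mathbb CH^n,g_h)=2n=\operatorname{Ent_v}(\mathbb CH^n,g_h).$$ Hence the bound in (1) is sharp: if $(X,g)$ is a compact connected Kähler manifold whose universal Kähler covering is $(\mathbb CH^n,g_h)$, then $(X,g)$ has the globally defined diastasis $\mathcal D^h$ and $\operatorname{Ent_d}(X,g)=2n=\operatorname{Ent_v}(X,g)$. -/

import Mathlib

open scoped Manifold ContDiff ENNReal ComplexConjugate
open MeasureTheory

noncomputable section

namespace Diastatic

/-! Complex manifolds are modelled on a finite-dimensional complex inner product space `E`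
(in the theorem `E = ℂⁿ`). The tangent space at `x` is identified with `E` through the preferred
chart `chartAt E x`, which is Mathlib's convention for `TangentSpace`. Multiplication by `i` on the
tangent space is then the complex structure `J`. -/

section Metric

variable {E : Type*} [NormedAddCommGroup E] [InnerProductSpace ℂ E]

/-- The real derivative of a map between manifolds modelled on `E`. -/
def realDeriv {M N : Type*} [TopologicalSpace M] [ChartedSpace E M]
    [TopologicalSpace N] [ChartedSpace E N] (f : M → N) (x : M) : E →L[ℝ] E :=
  mfderiv 𝓘(ℝ, E) 𝓘(ℝ, E) f x

variable {M : Type*} [TopologicalSpace M] [ChartedSpace E M]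

variable (E M) in
/-- A field of real bilinear forms on the tangent spaces of `M`. -/
abbrev MetricTensor : Type _ := M → E →L[ℝ] E →L[ℝ] ℝ

/-- The pull-back `π^* g`. -/
def pullbackMetric {N : Type*} [TopologicalSpace N] [ChartedSpace E N]
    (g : MetricTensor E N) (π : M → N) : MetricTensor E M :=
  fun x => (g (π x)).bilinearComp (realDeriv π x) (realDeriv π x)

/-- The expression of `g` in the chart `e` at the point `z ∈ e.target`. -/
def chartMetric (g : MetricTensor E M) (e : OpenPartialHomeomorph M E) (z : E) :
    E →L[ℝ] E →L[ℝ] ℝ :=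
  (g (e.symm z)).bilinearComp (realDeriv e.symm z) (realDeriv e.symm z)

/-- The form `ω (u, v) = g (J u, v)` in the chart `e`. -/
def chartForm (g : MetricTensor E M) (e : OpenPartialHomeomorph M E) (u v : E) (z : E) : ℝ :=
  chartMetric g e z (Complex.I • u) v

/-- `g` is a real analytic Kähler metric: a real analytic Riemannian metric which is invariant
under `J` and whose Kähler form is closed. -/
structure IsKahlerMetric (g : MetricTensor E M) : Prop where
  symm : ∀ x u v, g x u v = g x v u
  pos : ∀ x u, u ≠ 0 → 0 < g x u u
  hermitian : ∀ x u v, g x (Complex.I • u) (Complex.I • v) = g x u v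
  analytic : ∀ e ∈ atlas E M, ∀ u v : E,
    ContDiffOn ℝ ω (fun z => chartMetric g e z u v) e.target
  closed : ∀ e ∈ atlas E M, ∀ z ∈ e.target, ∀ u v w : E,
    fderiv ℝ (chartForm g e v w) z u + fderiv ℝ (chartForm g e w u) z v
      + fderiv ℝ (chartForm g e u v) z w = 0

/-- The norm of the tangent vector `v` at `x`. -/
def tangentNorm (g : MetricTensor E M) (x : M) (v : E) : ℝ≥0∞ :=
  ENNReal.ofReal (Real.sqrt (g x v v))

/-- The geodesic distance: the infimum of the `g`-lengths of the `C¹` paths from `x` to `y`. -/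
def geodesicDist (g : MetricTensor E M) (x y : M) : ℝ≥0∞ :=
  letI : ∀ x : M, ENorm (TangentSpace 𝓘(ℝ, E) x) := fun x => ⟨fun v => tangentNorm (E := E) g x v⟩
  Manifold.riemannianEDist 𝓘(ℝ, E) x y

/-- The gradient of `f` at `x`, i.e. the vector `G` with `g (G, v) = df (v)` for all `v`. -/
def gradient (g : MetricTensor E M) (f : M → ℝ) (x : M) : E :=
  Classical.epsilon fun G : E => ∀ v : E, g x G v = mfderiv 𝓘(ℝ, E) 𝓘(ℝ, ℝ) f x v

section Volume

variable [FiniteDimensional ℂ E] [MeasurableSpace E] [BorelSpace E] [MeasurableSpace M]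

/-- The density `√(det (g_{ij}))` of the Riemannian volume in the chart `e`, with respect to
Lebesgue measure; the coefficients are taken in a real orthonormal basis of `E`. -/
def volumeDensity (g : MetricTensor E M) (e : OpenPartialHomeomorph M E) (z : E) : ℝ :=
  letI : InnerProductSpace ℝ E := InnerProductSpace.rclikeToReal ℂ E
  Real.sqrt (Matrix.det (Matrix.of fun i j =>
    chartMetric g e z (stdOrthonormalBasis ℝ E i) (stdOrthonormalBasis ℝ E j)))

/-- The Riemannian volume measure: the supremum, over the charts `e` of the atlas, of the measures
on `e.source` which in the chart have density `√(det (g_{ij}))`. These measures agree on the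
overlaps of the charts, so on a second countable manifold their supremum is the measure that
restricts to each of them. -/
def riemannianVolume (g : MetricTensor E M) : Measure M :=
  letI : InnerProductSpace ℝ E := InnerProductSpace.rclikeToReal ℂ E
  ⨆ e ∈ atlas E M, Measure.map e.symm
    ((volume.restrict e.target).withDensity fun z => ENNReal.ofReal (volumeDensity g e z))

end Volume

section Diastasis

/-- The value at `x` of `(i/2) ∂∂̄ Φ` on `(u, v)`, in the coordinates `chartAt E x`. In terms of the
second derivative of `Φ` it is `(D²Φ (J u, v) - D²Φ (u, J v)) / 4`. -/
def halfIDdbar (Φ : M → ℝ) (x : M) (u v : E) : ℝ :=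
  let hess : E →L[ℝ] E →L[ℝ] ℝ :=
    fderiv ℝ (fderiv ℝ (Φ ∘ (chartAt E x).symm)) (chartAt E x x)
  (hess (Complex.I • u) v - hess u (Complex.I • v)) / 4

/-- `Φ` is a real analytic Kähler potential on `U`: `ω = (i/2) ∂∂̄ Φ` with `ω (u, v) = g (J u, v)`. -/
structure IsKahlerPotential (g : MetricTensor E M) (Φ : M → ℝ) (U : Set M) : Prop where
  analytic : ContMDiffOn 𝓘(ℝ, E) 𝓘(ℝ, ℝ) ω Φ U
  potential : ∀ x ∈ U, ∀ u v : E, g x (Complex.I • u) v = halfIDdbar Φ x u v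

/-- `Ψ (x, y) = Φ̂ (x, ȳ)` is the complex analytic continuation of `Φ` to `U × U`: it is holomorphic
in `x`, antiholomorphic in `y`, and restricts to `Φ` on the diagonal. -/
structure IsSesquiContinuation (E : Type*) [NormedAddCommGroup E] [InnerProductSpace ℂ E]
    {M : Type*} [TopologicalSpace M] [ChartedSpace E M]
    (Φ : M → ℝ) (Ψ : M → M → ℂ) (U : Set M) : Prop where
  holo_left : ∀ y ∈ U, MDifferentiableOn 𝓘(ℂ, E) 𝓘(ℂ, ℂ) (fun x => Ψ x y) U
  antiholo_right : ∀ x ∈ U, MDifferentiableOn 𝓘(ℂ, E) 𝓘(ℂ, ℂ) (fun y => conj (Ψ x y)) U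
  diag : ∀ x ∈ U, Ψ x x = (Φ x : ℂ)

/-- `D` is the globally defined diastasis of `(M, g)`: a real analytic function on `M × M` which
near every point of the diagonal is Calabi's diastasis of a Kähler potential. -/
structure IsGlobalDiastasis (g : MetricTensor E M) (D : M → M → ℝ) : Prop where
  analytic : ContMDiff (𝓘(ℝ, E).prod 𝓘(ℝ, E)) 𝓘(ℝ, ℝ) ω (fun p : M × M => D p.1 p.2)
  locally_calabi : ∀ p : M, ∃ (U : Set M) (Φ : M → ℝ) (Ψ : M → M → ℂ),
    IsOpen U ∧ p ∈ U ∧ IsKahlerPotential g Φ U ∧ IsSesquiContinuation E Φ Ψ U ∧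
    ∀ z ∈ U, ∀ w ∈ U, (D z w : ℂ) = Ψ z z + Ψ w w - Ψ z w - Ψ w z

/-- `𝒳(g) = sup_{y, z} ‖grad_y D_z‖`, where `D_z (y) = D (y, z)`. -/
def gradSup (g : MetricTensor E M) (D : M → M → ℝ) : ℝ≥0∞ :=
  ⨆ (y : M) (z : M), tangentNorm g y (gradient g (fun x => D x z) y)

end Diastasis

section Entropy

variable [FiniteDimensional ℂ E] [MeasurableSpace E] [BorelSpace E] [MeasurableSpace M]

/-- The `c > 0` with `∫ e^{-c D_w} ν_g < ∞`. -/
def diastaticExponents (g : MetricTensor E M) (D : M → M → ℝ) (w : M) : Set ℝ :=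
  {c | 0 < c ∧ ∫⁻ x, ENNReal.ofReal (Real.exp (-(c * D x w))) ∂(riemannianVolume g) < ⊤}

open Classical in
/-- The diastatic entropy of a simply connected `(M, g)` with diastasis `D`, computed with the base
point `w`; it is `∞` if `𝒳(g) = ∞` or if no exponent makes the integral finite. The diastatic
entropy of a compact manifold is that of its universal Kähler covering. -/
def diastaticEntropy (g : MetricTensor E M) (D : M → M → ℝ) (w : M) : ℝ≥0∞ :=
  if gradSup g D = ⊤ ∨ diastaticExponents g D w = ∅ then ⊤
  else gradSup g D * ⨅ c ∈ diastaticExponents g D w, ENNReal.ofReal c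

/-- The `c > 0` with `∫ e^{-c ρ(w, x)} ν_g(x) < ∞`. -/
def volumeExponents (g : MetricTensor E M) (w : M) : Set ℝ :=
  {c | 0 < c ∧
    ∫⁻ x, EReal.exp (-((c : EReal) * (geodesicDist g w x : EReal))) ∂(riemannianVolume g) < ⊤}

/-- The volume entropy of a simply connected `(M, g)`, computed with the base point `w`. The volume
entropy of a compact manifold is that of its universal Riemannian covering. -/
def volumeEntropy (g : MetricTensor E M) (w : M) : ℝ≥0∞ :=
  ⨅ c ∈ volumeExponents g w, ENNReal.ofReal c

end Entropy

/-- `π` is a holomorphic universal covering map. -/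
structure IsUniversalCovering (E : Type*) [NormedAddCommGroup E] [InnerProductSpace ℂ E]
    {M N : Type*} [TopologicalSpace M] [ChartedSpace E M] [TopologicalSpace N] [ChartedSpace E N]
    (π : M → N) : Prop where
  simplyConnected : SimplyConnectedSpace M
  covering : IsCoveringMap π
  locallyBiholomorphic : IsLocalDiffeomorph 𝓘(ℂ, E) 𝓘(ℂ, E) ω π

end Metric

section Hyperbolic

/-- The unit ball of `ℂⁿ`, as an open submanifold. -/
def complexBall (n : ℕ) : TopologicalSpace.Opens (EuclideanSpace ℂ (Fin n)) :=
  ⟨Metric.ball 0 1, Metric.isOpen_ball⟩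

/-- Complex hyperbolic space `ℂHⁿ` (its underlying complex manifold). -/
abbrev CH (n : ℕ) : Type := complexBall n

/-- The bilinear form `(u, v) ↦ Re (⟨u, z⟩ ⟨z, v⟩)`. -/
def rankOneForm {E : Type*} [NormedAddCommGroup E] [InnerProductSpace ℂ E] (z : E) :
    E →L[ℝ] E →L[ℝ] ℝ :=
  let l : E →L[ℝ] ℂ := (innerSL ℂ z).restrictScalars ℝ
  (Complex.reCLM ∘L l).smulRight (Complex.reCLM ∘L l)
    + (Complex.imCLM ∘L l).smulRight (Complex.imCLM ∘L l)

lemma rankOneForm_apply {E : Type*} [NormedAddCommGroup E] [InnerProductSpace ℂ E] (z u v : E) :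
    rankOneForm z u v = (inner ℂ u z * inner ℂ z v).re := by
  have h : rankOneForm z u v = (inner ℂ z u).re * (inner ℂ z v).re
      + (inner ℂ z u).im * (inner ℂ z v).im := rfl
  rw [h, ← inner_conj_symm u z, Complex.mul_re, Complex.conj_re, Complex.conj_im]
  ring

/-- The value at `z`, `‖z‖ < 1`, of the hyperbolic metric on the unit ball:
`(u, v) ↦ Re ⟨u, v⟩ / (1 - ‖z‖²) + Re (⟨u, z⟩ ⟨z, v⟩) / (1 - ‖z‖²)²`. -/
def hypForm {E : Type*} [NormedAddCommGroup E] [InnerProductSpace ℂ E] (z : E) :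
    E →L[ℝ] E →L[ℝ] ℝ :=
  letI : InnerProductSpace ℝ E := InnerProductSpace.rclikeToReal ℂ E
  let euclid : E →L[ℝ] E →L[ℝ] ℝ := innerSL ℝ
  (1 - ‖z‖ ^ 2)⁻¹ • euclid + ((1 - ‖z‖ ^ 2) ^ 2)⁻¹ • rankOneForm z

lemma hypForm_apply {E : Type*} [NormedAddCommGroup E] [InnerProductSpace ℂ E] (z u v : E) :
    hypForm z u v = (inner ℂ u v).re / (1 - ‖z‖ ^ 2)
      + (inner ℂ u z * inner ℂ z v).re / (1 - ‖z‖ ^ 2) ^ 2 := by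
  let : InnerProductSpace ℝ E := InnerProductSpace.rclikeToReal ℂ E
  have h : (innerSL ℝ u : E →L[ℝ] ℝ) v = (inner ℂ u v).re := rfl
  simp only [hypForm, add_apply, smul_apply,
    rankOneForm_apply, smul_eq_mul, h]
  ring

/-- The hyperbolic metric `g_h` of constant holomorphic sectional curvature `-4` on the ball; its
Kähler form is `-(i/2) ∂∂̄ log (1 - ‖z‖²)`. -/
def hypMetric (n : ℕ) : MetricTensor (EuclideanSpace ℂ (Fin n)) (CH n) :=
  fun z => hypForm (z : EuclideanSpace ℂ (Fin n))

/-- The diastasis `D^h (w, z) = - log ((1 - ‖z‖²) (1 - ‖w‖²) / |1 - z w^*|²)`. -/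
def hypDiastasis (n : ℕ) (w z : CH n) : ℝ :=
  -Real.log ((1 - ‖(z : EuclideanSpace ℂ (Fin n))‖ ^ 2)
      * (1 - ‖(w : EuclideanSpace ℂ (Fin n))‖ ^ 2)
    / ‖1 - inner ℂ (w : EuclideanSpace ℂ (Fin n)) (z : EuclideanSpace ℂ (Fin n))‖ ^ 2)

end Hyperbolic

end Diastatic

end

/-! Part (1) is a Lipschitz estimate. If `C > 0` bounds the gradients of the diastasis, integration
along paths gives `D(x, w) ≤ D(w', w) + C ρ(w', x)`. Hence `e^{-cCρ}` is at most a constant times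
`e^{-c D_w}`, and every diastatic exponent `c` yields the volume exponent `cC`
(`mul_mem_volumeExponents`). The base points only affect the constant; of the metric only positive
definiteness is needed, and of `D_w` only `C¹` regularity.

For the ball, the sesquiholomorphic extension of the potential is `-log (1 - ⟨y, x⟩)`, single-valued
because `1 - ⟨y, x⟩` has positive real part. The gradient bound 2 comes from Cauchy–Schwarz
(`sq_norm_differential_le`) and is approached along a radius when `n ≥ 1`. The factor `|1 - ⟨x, w⟩|`
stays between two positive constants for fixed `w`, so `e^{-c D_w}` is comparable to `(1 - ‖x‖²)^c`.
The volume density is `(1 - ‖x‖²)^{-(n+1)}` (`det_hypForm`), and polar coordinates show convergence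
exactly for `c > n` when `n ≥ 1`. This gives diastatic entropy `2n`.

The volume entropy is at most `2n` by the general inequality. Conversely, radial paths give `ρ(w, x)
≤ K - log (1 - ‖x‖²) / 2`, so a volume exponent `c` makes the integral of `(1 - ‖x‖²)^{c/2}` finite
and `c/2 ≥ n`. No lower bound of the distance has to be computed. In dimension 0 the ball is a point
and both entropies vanish. -/

noncomputable section

namespace Diastatic

/-! ### Gradients, Lipschitz estimates and the general entropy inequality. -/

section Metric

variable {E : Type*} [NormedAddCommGroup E] [InnerProductSpace ℂ E]

/-- The Cauchy–Schwarz inequality for a positive semidefinite symmetric form. -/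
lemma sq_apply_le_of_symm (B : E →L[ℝ] E →L[ℝ] ℝ) (hs : ∀ u v, B u v = B v u)
    (hp : ∀ u, 0 ≤ B u u) (u v : E) : B u v ^ 2 ≤ B u u * B v v := by
  let B' : LinearMap.BilinForm ℝ E := LinearMap.mk₂ ℝ (fun u v => B u v)
    (by simp) (by simp) (by simp) (by simp)
  have h := LinearMap.BilinForm.apply_mul_apply_le_of_forall_zero_le B' hp u v
  have h' : B u v * B v u ≤ B u u * B v v := h
  rwa [← hs u v, ← sq] at h'

lemma abs_apply_le_of_symm (B : E →L[ℝ] E →L[ℝ] ℝ) (hs : ∀ u v, B u v = B v u)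
    (hp : ∀ u, 0 ≤ B u u) (u v : E) : |B u v| ≤ √(B u u) * √(B v v) := by
  rw [← Real.sqrt_mul (hp u)]
  exact Real.abs_le_sqrt (sq_apply_le_of_symm B hs hp u v)

/-- A positive definite form on a finite-dimensional space represents every linear functional. -/
lemma exists_apply_eq_of_posDef [FiniteDimensional ℂ E] (B : E →L[ℝ] E →L[ℝ] ℝ)
    (hp : ∀ u, u ≠ 0 → 0 < B u u) (l : E →L[ℝ] ℝ) : ∃ G, ∀ v, B G v = l v := by
  have : FiniteDimensional ℝ E := FiniteDimensional.complexToReal E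
  have inj : Function.Injective (B : E →ₗ[ℝ] E →L[ℝ] ℝ) := by
    rw [← LinearMap.ker_eq_bot, LinearMap.ker_eq_bot']
    intro u hu
    by_contra h
    have := hp u h
    have h0 : B u = 0 := hu
    simp [h0] at this
  have dim : Module.finrank ℝ E = Module.finrank ℝ (E →L[ℝ] ℝ) := by
    rw [← (LinearMap.toContinuousLinearMap (𝕜 := ℝ) (E := E) (F' := ℝ)).finrank_eq]
    exact (Subspace.dual_finrank_eq (K := ℝ) (V := E)).symm
  obtain ⟨G, hG⟩ := (LinearMap.injective_iff_surjective_of_finrank_eq_finrank dim).1 inj l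
  exact ⟨G, fun v => DFunLike.congr_fun hG v⟩

section PosDef

variable {M : Type*}

/-- Every tangent space carries a positive definite symmetric form. -/
structure IsPosDef (g : MetricTensor E M) : Prop where
  symm : ∀ x u v, g x u v = g x v u
  pos : ∀ x u, u ≠ 0 → 0 < g x u u

lemma IsPosDef.nonneg {g : MetricTensor E M} (hg : IsPosDef g) (x : M) (u : E) :
    0 ≤ g x u u := by
  by_cases h : u = 0
  · simp [h]
  · exact (hg.pos x u h).le

lemma IsPosDef.abs_apply_le {g : MetricTensor E M} (hg : IsPosDef g) (x : M) (u v : E) :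
    |g x u v| ≤ √(g x u u) * √(g x v v) :=
  abs_apply_le_of_symm (g x) (hg.symm x) (hg.nonneg x) u v

end PosDef

variable {M : Type*} [TopologicalSpace M] [ChartedSpace E M]

/-- The differential of a real function. -/
def differential (f : M → ℝ) (x : M) : E →L[ℝ] ℝ :=
  mfderiv 𝓘(ℝ, E) 𝓘(ℝ, ℝ) f x

/-- Nondegeneracy in finite dimension provides a representing vector, so the choice in `gradient` is
not a junk value. -/
lemma IsPosDef.gradient_apply [FiniteDimensional ℂ E] {g : MetricTensor E M} (hg : IsPosDef g)
    (f : M → ℝ) (x : M) (v : E) :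
    g x (gradient g f x) v = differential f x v :=
  Classical.epsilon_spec (exists_apply_eq_of_posDef (g x) (hg.pos x) (differential f x)) v

/-- The differential is bounded by the norm of the gradient. -/
lemma IsPosDef.abs_mfderiv_le [FiniteDimensional ℂ E] {g : MetricTensor E M} (hg : IsPosDef g)
    (f : M → ℝ) (x : M) (v : E) {C : ℝ} (hC : 0 ≤ C)
    (h : tangentNorm g x (gradient g f x) ≤ ENNReal.ofReal C) :
    |differential f x v| ≤ C * √(g x v v) := by
  rw [← hg.gradient_apply f x v]
  refine (hg.abs_apply_le x _ v).trans ?_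
  gcongr
  exact (ENNReal.ofReal_le_ofReal_iff hC).1 h

/-- A bound of the differential bounds the norm of the gradient. -/
lemma IsPosDef.tangentNorm_gradient_le [FiniteDimensional ℂ E] {g : MetricTensor E M}
    (hg : IsPosDef g) (f : M → ℝ) (x : M) {C : ℝ} (hC : 0 ≤ C)
    (h : ∀ v : E, differential f x v ≤ C * √(g x v v)) :
    tangentNorm g x (gradient g f x) ≤ ENNReal.ofReal C := by
  refine ENNReal.ofReal_le_ofReal ?_
  have h1 := h (gradient g f x)
  rw [← hg.gradient_apply f x] at h1
  rcases (Real.sqrt_nonneg (g x (gradient g f x) (gradient g f x))).eq_or_lt with h0 | h0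
  · rwa [← h0]
  · rw [← Real.mul_self_sqrt (hg.nonneg x _)] at h1
    rw [Real.sqrt_mul_self h0.le] at h1
    exact le_of_mul_le_mul_right h1 h0

/-- The metric makes every tangent space an `ENorm` space. -/
@[reducible]
def tangentENorm (g : MetricTensor E M) (x : M) : ENorm (TangentSpace 𝓘(ℝ, E) x) :=
  ⟨fun v => tangentNorm (E := E) g x v⟩

lemma geodesicDist_eq (g : MetricTensor E M) (x y : M) :
    geodesicDist g x y =
      letI := tangentENorm g; Manifold.riemannianEDist 𝓘(ℝ, E) x y := rfl

/-- Homogeneity makes path length invariant under reparametrization, which symmetry and the triangle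
inequality of the distance rest on. -/
lemma tangentENorm_smulClass (g : MetricTensor E M) (x : M) :
    letI := tangentENorm g x; ENormSMulClass ℝ (TangentSpace 𝓘(ℝ, E) x) := by
  let := tangentENorm g x
  refine ⟨fun r (v : E) => ?_⟩
  change ENNReal.ofReal √(g x (r • v) (r • v)) = ‖r‖ₑ * ENNReal.ofReal √(g x v v)
  have : g x (r • v) (r • v) = (r * r) * g x v v := by
    simp only [map_smul, smul_apply, smul_eq_mul, mul_assoc]
  rw [this, Real.sqrt_mul (mul_self_nonneg r), Real.sqrt_mul_self_eq_abs,
    ENNReal.ofReal_mul (abs_nonneg r), Real.enorm_eq_ofReal_abs]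

/-- A `C¹` function whose differential is bounded by `C` is `C`-Lipschitz for the geodesic
distance. -/
lemma ofReal_sub_le_mul_geodesicDist (g : MetricTensor E M) {f : M → ℝ}
    (hf : ContMDiff 𝓘(ℝ, E) 𝓘(ℝ, ℝ) 1 f) {C : ℝ} (hC : 0 < C)
    (h : ∀ (x : M) (v : E), |differential f x v| ≤ C * √(g x v v)) (x y : M) :
    ENNReal.ofReal (f y - f x) ≤ ENNReal.ofReal C * geodesicDist g x y := by
  let := tangentENorm g
  have hC0 : ENNReal.ofReal C ≠ 0 := by simpa using hC
  rw [geodesicDist_eq, ← ENNReal.div_le_iff' hC0 ENNReal.ofReal_ne_top]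
  refine le_of_forall_gt fun r hr => ?_
  obtain ⟨γ, h0, h1, hγ, hlen⟩ := Manifold.exists_lt_of_riemannianEDist_lt hr
  refine lt_of_le_of_lt ?_ hlen
  rw [ENNReal.div_le_iff' hC0 ENNReal.ofReal_ne_top]
  have hfγ : ContDiffOn ℝ 1 (f ∘ γ) (Set.Icc 0 1) :=
    contMDiffOn_iff_contDiffOn.1 (hf.comp_contMDiffOn hγ)
  have key := enorm_sub_le_lintegral_deriv_of_contDiffOn_Icc hfγ zero_le_one
  have e : ENNReal.ofReal (f y - f x) ≤ ‖(f ∘ γ) 1 - (f ∘ γ) 0‖ₑ := by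
    rw [Function.comp_apply, Function.comp_apply, h0, h1, Real.enorm_eq_ofReal_abs]
    exact ENNReal.ofReal_le_ofReal (le_abs_self _)
  refine (e.trans key).trans ?_
  rw [Manifold.pathELength_eq_lintegral_mfderiv_Icc,
    ← lintegral_const_mul' _ _ ENNReal.ofReal_ne_top, ← restrict_Ioo_eq_restrict_Icc]
  -- The endpoints are null; at interior times the path is differentiable in the full sense and the
  -- chain rule applies.
  refine setLIntegral_mono' measurableSet_Ioo fun t ht => ?_
  have hγt : MDifferentiableAt 𝓘(ℝ, ℝ) 𝓘(ℝ, E) γ t :=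
    ((hγ t ⟨ht.1.le, ht.2.le⟩).contMDiffAt (Icc_mem_nhds ht.1 ht.2)).mdifferentiableAt one_ne_zero
  have hft : MDifferentiableAt 𝓘(ℝ, E) 𝓘(ℝ, ℝ) f (γ t) := (hf _).mdifferentiableAt one_ne_zero
  let γ' : ℝ →L[ℝ] E := mfderiv 𝓘(ℝ, ℝ) 𝓘(ℝ, E) γ t
  have hc : HasMFDerivAt 𝓘(ℝ, ℝ) 𝓘(ℝ, ℝ) (f ∘ γ) t
      ((differential f (γ t)).comp γ' : ℝ →L[ℝ] ℝ) :=
    hft.hasMFDerivAt.comp t hγt.hasMFDerivAt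
  have hc' : HasFDerivAt (f ∘ γ) ((differential f (γ t)).comp γ') t := hc.hasFDerivAt
  have hd : deriv (f ∘ γ) t = differential f (γ t) (γ' 1) := hc'.hasDerivAt.deriv
  rw [hd, Real.enorm_eq_ofReal_abs]
  change _ ≤ ENNReal.ofReal C * ENNReal.ofReal _
  rw [← ENNReal.ofReal_mul hC.le]
  exact ENNReal.ofReal_le_ofReal (h _ _)

section Entropy

variable [FiniteDimensional ℂ E] [MeasurableSpace E] [BorelSpace E] [MeasurableSpace M]

/-- Since `D_w` is `C`-Lipschitz, `e^{-cCρ(w', x)} ≤ e^{c D(w', w)} e^{-c D(x, w)}`. A positive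
upper bound `C` replaces the supremum itself, which may be 0 and would then not give a positive
exponent. -/
lemma mul_mem_volumeExponents {g : MetricTensor E M} (hg : IsPosDef g) {D : M → M → ℝ}
    {w : M} (hD : ContMDiff 𝓘(ℝ, E) 𝓘(ℝ, ℝ) 1 fun x => D x w) {C : ℝ} (hC : 0 < C)
    (hX : gradSup g D ≤ ENNReal.ofReal C) {c : ℝ} (hc : c ∈ diastaticExponents g D w) (w' : M) :
    c * C ∈ volumeExponents g w' := by
  refine ⟨mul_pos hc.1 hC, ?_⟩
  have bound : ∀ x, EReal.exp (-(((c * C : ℝ) : EReal) * (geodesicDist g w' x : EReal))) ≤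
      ENNReal.ofReal (Real.exp (c * D w' w)) * ENNReal.ofReal (Real.exp (-(c * D x w))) := by
    intro x
    have hL := ofReal_sub_le_mul_geodesicDist g hD hC (fun y v => hg.abs_mfderiv_le _ y v hC.le
      ((le_iSup₂ (f := fun y z => tangentNorm g y (gradient g (fun x => D x z) y)) y w).trans hX))
      w' x
    -- At infinite distance the exponential on the left is 0.
    rcases eq_or_ne (geodesicDist g w' x) ⊤ with ht | ht
    · rw [ht, EReal.coe_ennreal_top, EReal.coe_mul_top_of_pos (mul_pos hc.1 hC)]
      simp
    · lift geodesicDist g w' x to NNReal using ht with ρ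
      rw [← ENNReal.ofReal_coe_nnreal, ← ENNReal.ofReal_mul hC.le,
        ENNReal.ofReal_le_ofReal_iff (by positivity)] at hL
      rw [← ENNReal.ofReal_mul (Real.exp_nonneg _), ← Real.exp_add,
        ← ENNReal.ofReal_coe_nnreal, EReal.coe_ennreal_ofReal, max_eq_left ρ.coe_nonneg, ← EReal.coe_mul,
        ← EReal.coe_neg, EReal.exp_coe]
      refine ENNReal.ofReal_le_ofReal (Real.exp_le_exp.2 ?_)
      have := mul_le_mul_of_nonneg_left hL hc.1.le
      nlinarith
  refine (lintegral_mono bound).trans_lt ?_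
  rw [lintegral_const_mul' _ _ ENNReal.ofReal_ne_top]
  exact ENNReal.mul_lt_top ENNReal.ofReal_lt_top hc.2

/-- The volume entropy is at most the diastatic entropy, whatever the base points. -/
lemma volumeEntropy_le_diastaticEntropy {g : MetricTensor E M} (hg : IsPosDef g) {D : M → M → ℝ}
    {w : M} (hD : ContMDiff 𝓘(ℝ, E) 𝓘(ℝ, ℝ) 1 fun x => D x w) (w' : M) :
    volumeEntropy g w' ≤ diastaticEntropy g D w := by
  rw [diastaticEntropy]
  split_ifs with h
  · exact le_top
  push Not at h
  obtain ⟨hX, c₀, hc₀⟩ := h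
  have key : ∀ C : ℝ, 0 < C → gradSup g D ≤ ENNReal.ofReal C → ∀ c ∈ diastaticExponents g D w,
      volumeEntropy g w' ≤ ENNReal.ofReal C * ENNReal.ofReal c := by
    intro C hC hCX c hc
    rw [mul_comm, ← ENNReal.ofReal_mul hc.1.le]
    exact iInf₂_le (c * C) (mul_mem_volumeExponents hg hD hC hCX hc w')
  rcases eq_or_ne (gradSup g D) 0 with h0 | h0
  · rw [h0, zero_mul, nonpos_iff_eq_zero]
    by_contra hne
    have hfin : volumeEntropy g w' ≠ ⊤ :=
      ne_top_of_le_ne_top (by finiteness) (key 1 one_pos (by simp [h0]) c₀ hc₀)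
    have hpos : 0 < (volumeEntropy g w').toReal := ENNReal.toReal_pos hne hfin
    -- With vanishing gradients every `C > 0` is admissible; this one would bound the entropy `v` by
    -- `v / 2`.
    have h2 := key ((volumeEntropy g w').toReal / (2 * c₀)) (div_pos hpos (by linarith [hc₀.1]))
      (by simp [h0]) c₀ hc₀
    have hc := hc₀.1
    rw [← ENNReal.ofReal_mul (by positivity), ENNReal.le_ofReal_iff_toReal_le hfin (by positivity)]
      at h2
    have : (volumeEntropy g w').toReal / (2 * c₀) * c₀ = (volumeEntropy g w').toReal / 2 := by
      field_simp
    linarith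
  · simp_rw [ENNReal.mul_iInf_of_ne h0 hX]
    refine le_iInf₂ fun c hc => ?_
    have := key (gradSup g D).toReal (ENNReal.toReal_pos h0 hX) (ENNReal.ofReal_toReal hX).ge c hc
    rwa [ENNReal.ofReal_toReal hX] at this

end Entropy

/-! ### Pull-back under a locally biholomorphic map. -/

lemma _root_.HasMFDerivAt.complexToReal {F : Type*} [NormedAddCommGroup F] [NormedSpace ℂ F]
    {N : Type*} [TopologicalSpace N] [ChartedSpace F N] {f : M → N} {x : M} {f' : E →L[ℂ] F}
    (h : HasMFDerivAt 𝓘(ℂ, E) 𝓘(ℂ, F) f x f') :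
    HasMFDerivAt 𝓘(ℝ, E) 𝓘(ℝ, F) f x (f'.restrictScalars ℝ : E →L[ℝ] F) :=
  ⟨h.1, h.2.restrictScalars ℝ⟩

lemma realDeriv_injective_of_isLocalDiffeomorph {N : Type*} [TopologicalSpace N] [ChartedSpace E N]
    [IsManifold 𝓘(ℂ, E) ω M] [IsManifold 𝓘(ℂ, E) ω N]
    {π : M → N} (hπ : IsLocalDiffeomorph 𝓘(ℂ, E) 𝓘(ℂ, E) ω π) (x : M) :
    Function.Injective (realDeriv π x : E → E) := by
  have he : (realDeriv π x : E → E) = mfderiv 𝓘(ℂ, E) 𝓘(ℂ, E) π x :=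
    congrArg DFunLike.coe
      ((hπ x).mdifferentiableAt (by simp)).hasMFDerivAt.complexToReal.mfderiv
  rw [he]
  exact ((hπ x).mfderivToContinuousLinearEquiv (by simp)).injective

/-- The differential of a local biholomorphism is injective, so definiteness survives the pull-back.
-/
lemma IsKahlerMetric.isPosDef_pullbackMetric {N : Type*} [TopologicalSpace N] [ChartedSpace E N]
    [IsManifold 𝓘(ℂ, E) ω M] [IsManifold 𝓘(ℂ, E) ω N]
    {g : MetricTensor E N} (hg : IsKahlerMetric g)
    {π : M → N} (hπ : IsLocalDiffeomorph 𝓘(ℂ, E) 𝓘(ℂ, E) ω π) :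
    IsPosDef (pullbackMetric g π) where
  symm _ _ _ := hg.symm _ _ _
  pos x _ hu := hg.pos _ _ fun h => hu
    (realDeriv_injective_of_isLocalDiffeomorph hπ x (h.trans (map_zero (realDeriv π x)).symm))

lemma IsGlobalDiastasis.contMDiff_left {g : MetricTensor E M} {D : M → M → ℝ}
    (hD : IsGlobalDiastasis g D) (w : M) : ContMDiff 𝓘(ℝ, E) 𝓘(ℝ, ℝ) 1 fun x => D x w :=
  (hD.analytic.of_le le_top).comp (contMDiff_id.prodMk contMDiff_const)

end Metric

/-! ### Open subsets of a vector space: the inclusion is the only chart. -/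

section Opens

variable {E : Type*} [NormedAddCommGroup E] {U : TopologicalSpace.Opens E}

namespace Opens

lemma chartAt_target (x : U) : (chartAt E x).target = U := by
  rw [TopologicalSpace.Opens.chartAt_eq, OpenPartialHomeomorph.subtypeRestr_def]
  simp [chartAt_self_eq]

lemma chartAt_apply (x y : U) : chartAt E x y = y := by
  simp [TopologicalSpace.Opens.chartAt_eq, OpenPartialHomeomorph.subtypeRestr_coe, chartAt_self_eq]

lemma coe_chartAt_symm (x : U) {z : E} (hz : z ∈ U) : (((chartAt E x).symm z : U) : E) = z := by
  rw [← chartAt_apply x, (chartAt E x).right_inv]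
  rwa [chartAt_target]

lemma chartAt_symm (x : U) {z : E} (hz : z ∈ U) : (chartAt E x).symm z = ⟨z, hz⟩ :=
  Subtype.ext (coe_chartAt_symm x hz)

/-- The atlas has a single member, so the supremum defining the Riemannian volume has one term. -/
lemma eq_chartAt (x : U) {e : OpenPartialHomeomorph U E} (he : e ∈ atlas E U) :
    e = chartAt E x := by
  obtain ⟨y, hy⟩ := TopologicalSpace.Opens.chart_eq ⟨x⟩ he
  simpa [TopologicalSpace.Opens.chartAt_eq, chartAt_self_eq] using hy

variable [InnerProductSpace ℂ E]

lemma hasMFDerivAt_val (x : U) :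
    HasMFDerivAt 𝓘(ℝ, E) 𝓘(ℝ, E) (Subtype.val : U → E) x (ContinuousLinearMap.id ℝ E) := by
  have h : HasFDerivAt (writtenInExtChartAt 𝓘(ℝ, E) 𝓘(ℝ, E) x (Subtype.val : U → E))
      (ContinuousLinearMap.id ℝ E) (x : E) := by
    refine (hasFDerivAt_id _).congr_of_eventuallyEq ?_
    filter_upwards [U.2.mem_nhds x.2] with z hz
    simp only [mfld_simps, chartAt_self_eq, coe_chartAt_symm x hz]
  rw [← chartAt_apply x x] at h
  exact ⟨continuous_subtype_val.continuousAt, h.hasFDerivWithinAt⟩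

lemma hasMFDerivAt_comp_val {F : Type*} [NormedAddCommGroup F] [NormedSpace ℝ F]
    {f : E → F} {x : U} {f' : E →L[ℝ] F} (h : HasFDerivAt f f' x) :
    HasMFDerivAt 𝓘(ℝ, E) 𝓘(ℝ, F) (fun y : U => f y) x f' := by
  have := HasMFDerivAt.comp x h.hasMFDerivAt (hasMFDerivAt_val x)
  exact this

lemma contMDiff_val {k : WithTop ℕ∞} :
    ContMDiff 𝓘(ℝ, E) 𝓘(ℝ, E) k (Subtype.val : U → E) := contMDiff_subtype_val

lemma realDeriv_chartAt_symm (x : U) {z : E} (hz : z ∈ U) :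
    realDeriv (chartAt E x).symm z = ContinuousLinearMap.id ℝ E := by
  have hz' : z ∈ (chartAt E x).target := by rwa [chartAt_target]
  have h : HasFDerivAt (writtenInExtChartAt 𝓘(ℝ, E) 𝓘(ℝ, E) z (chartAt E x).symm)
      (ContinuousLinearMap.id ℝ E) z := by
    refine (hasFDerivAt_id _).congr_of_eventuallyEq ?_
    filter_upwards [U.2.mem_nhds hz] with y hy
    simp only [mfld_simps, chartAt_apply, chartAt_self_eq, coe_chartAt_symm x hy]
  exact HasMFDerivAt.mfderiv ⟨(chartAt E x).symm.continuousAt hz', h.hasFDerivWithinAt⟩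

lemma chartMetric_chartAt (g : MetricTensor E U) (x : U) {z : E} (hz : z ∈ U) (u v : E) :
    chartMetric g (chartAt E x) z u v = g ⟨z, hz⟩ u v := by
  rw [chartMetric, realDeriv_chartAt_symm x hz, chartAt_symm x hz]
  rfl

/-- The derivative of a curve in an open set is that of the curve in the ambient space. -/
lemma mfderiv_curve {γ : ℝ → U} {t : ℝ} {v : E}
    (hγ : MDifferentiableAt 𝓘(ℝ, ℝ) 𝓘(ℝ, E) γ t)
    (h : HasDerivAt (fun s => (γ s : E)) v t) :
    (mfderiv 𝓘(ℝ, ℝ) 𝓘(ℝ, E) γ t : ℝ →L[ℝ] E) (1 : ℝ) = v := by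
  let γ' : ℝ →L[ℝ] E := mfderiv 𝓘(ℝ, ℝ) 𝓘(ℝ, E) γ t
  have hc : HasMFDerivAt 𝓘(ℝ, ℝ) 𝓘(ℝ, E) (Subtype.val ∘ γ) t
      ((ContinuousLinearMap.id ℝ E).comp γ' : ℝ →L[ℝ] E) :=
    (hasMFDerivAt_val _).comp t hγ.hasMFDerivAt
  have hc' : HasFDerivAt (Subtype.val ∘ γ) ((ContinuousLinearMap.id ℝ E).comp γ') t :=
    hc.hasFDerivAt
  exact hc'.hasDerivAt.unique h

end Opens

end Opens

/-! ### Differential calculus of the hyperbolic potential. -/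

section Calculus

variable {E : Type*} [NormedAddCommGroup E] [InnerProductSpace ℂ E]

/-- The real part of the inner product. -/
def reInner : E →L[ℝ] E →L[ℝ] ℝ :=
  letI : InnerProductSpace ℝ E := InnerProductSpace.rclikeToReal ℂ E
  innerSL ℝ

lemma reInner_apply (u v : E) : reInner u v = (inner ℂ u v).re := rfl

lemma reInner_self (u : E) : reInner u u = ‖u‖ ^ 2 := by
  rw [reInner_apply, inner_self_eq_norm_sq_to_K]
  norm_cast

lemma hasFDerivAt_norm_sq (z : E) :
    HasFDerivAt (fun y : E => ‖y‖ ^ 2) ((2 : ℝ) • reInner z) z := by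
  have h := (reInner (E := E)).hasFDerivAt_of_bilinear (hasFDerivAt_id z) (hasFDerivAt_id z)
  simp only [id, reInner_self] at h
  refine h.congr_fderiv ?_
  ext v
  have : reInner v z = reInner z v := by
    rw [reInner_apply, reInner_apply, ← inner_conj_symm, Complex.conj_re]
  simp [this, two_mul]

/-- The potential `- log (1 - ‖z‖²)` of the hyperbolic metric. -/
def hypPotential (z : E) : ℝ := -Real.log (1 - ‖z‖ ^ 2)

lemma one_sub_norm_sq_pos {E : Type*} [NormedAddCommGroup E] {z : E} (hz : ‖z‖ < 1) : 0 < 1 - ‖z‖ ^ 2 := by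
  nlinarith [norm_nonneg z]

lemma hasFDerivAt_hypPotential {z : E} (hz : ‖z‖ < 1) :
    HasFDerivAt hypPotential ((2 * (1 - ‖z‖ ^ 2)⁻¹) • reInner z) z := by
  have h := (((hasFDerivAt_norm_sq z).const_sub 1).log (one_sub_norm_sq_pos hz).ne').neg
  refine h.congr_fderiv ?_
  ext v
  simp
  ring

lemma hasFDerivAt_fderiv_hypPotential {z : E} (hz : ‖z‖ < 1) :
    HasFDerivAt (fderiv ℝ (hypPotential (E := E)))
      ((2 * (1 - ‖z‖ ^ 2)⁻¹) • reInner
        + ((4 * ((1 - ‖z‖ ^ 2) ^ 2)⁻¹) • reInner z).smulRight (reInner z)) z := by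
  have hs := (one_sub_norm_sq_pos hz).ne'
  have h1 : HasFDerivAt (fun y : E => 2 * (1 - ‖y‖ ^ 2)⁻¹)
      ((4 * ((1 - ‖z‖ ^ 2) ^ 2)⁻¹) • reInner z) z := by
    have h := ((hasDerivAt_inv hs).comp_hasFDerivAt z
      ((hasFDerivAt_norm_sq z).const_sub 1)).const_mul 2
    refine h.congr_fderiv ?_
    ext v
    simp
    ring
  have h2 := h1.smul (reInner (E := E)).hasFDerivAt
  refine h2.congr_of_eventuallyEq ?_
  filter_upwards [Metric.isOpen_ball.mem_nhds (mem_ball_zero_iff.2 hz)] with y hy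
  exact (hasFDerivAt_hypPotential (mem_ball_zero_iff.1 hy)).fderiv

/-- With `s = 1 - ‖z‖²`, the Hessian of the potential is `2 Re⟨u, v⟩ / s + 4 Re⟨z, u⟩ Re⟨z, v⟩ /
s²`; its `J`-antisymmetrization is the Kähler form of the hyperbolic metric. -/
lemma hypForm_I_smul {z : E} (hz : ‖z‖ < 1) (u v : E) :
    hypForm z (Complex.I • u) v =
      (fderiv ℝ (fderiv ℝ (hypPotential (E := E))) z (Complex.I • u) v
        - fderiv ℝ (fderiv ℝ (hypPotential (E := E))) z u (Complex.I • v)) / 4 := by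
  rw [(hasFDerivAt_fderiv_hypPotential hz).fderiv, hypForm_apply, ← inner_conj_symm _ z]
  simp only [add_apply, smul_apply,
    ContinuousLinearMap.smulRight_apply, reInner_apply, inner_smul_left, inner_smul_right,
    smul_eq_mul, Complex.conj_I, Complex.mul_re, Complex.I_re, Complex.I_im, Complex.neg_re,
    Complex.neg_im, map_mul, Complex.conj_re, Complex.conj_im, Complex.mul_im]
  ring

/-- Keeps the argument of the principal logarithm off its cut on the whole ball. -/
lemma one_sub_inner_re_pos {w z : E} (hw : ‖w‖ < 1) (hz : ‖z‖ < 1) :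
    0 < (1 - inner ℂ w z).re := by
  have h1 : (inner ℂ w z).re ≤ ‖w‖ * ‖z‖ := (Complex.re_le_norm _).trans (norm_inner_le_norm w z)
  have h2 : ‖w‖ * ‖z‖ < 1 := by nlinarith [norm_nonneg w, norm_nonneg z]
  simp only [Complex.sub_re, Complex.one_re]
  linarith

lemma one_sub_inner_mem_slitPlane {w z : E} (hw : ‖w‖ < 1) (hz : ‖z‖ < 1) :
    1 - inner ℂ w z ∈ Complex.slitPlane := Or.inl (one_sub_inner_re_pos hw hz)

lemma one_sub_inner_ne_zero {w z : E} (hw : ‖w‖ < 1) (hz : ‖z‖ < 1) : 1 - inner ℂ w z ≠ 0 :=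
  Complex.slitPlane_ne_zero (one_sub_inner_mem_slitPlane hw hz)

lemma hasFDerivAt_log_one_sub_inner {w z : E} (hw : ‖w‖ < 1) (hz : ‖z‖ < 1) :
    HasFDerivAt (fun y => Complex.log (1 - inner ℂ w y))
      ((1 - inner ℂ w z)⁻¹ • -(innerSL ℂ w)) z :=
  ((innerSL ℂ w).hasFDerivAt.const_sub 1).clog (one_sub_inner_mem_slitPlane hw hz)

/-- The differential of the diastasis is bounded by `2` in the hyperbolic metric. -/
lemma sq_norm_differential_le {y z : E} (hy : ‖y‖ < 1) (hz : ‖z‖ < 1) (v : E) :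
    ‖inner ℂ y v / (1 - ‖y‖ ^ 2 : ℝ) - inner ℂ z v / (1 - inner ℂ z y)‖ ^ 2 ≤ hypForm y v v := by
  have hs := one_sub_norm_sq_pos hy
  set s := 1 - ‖y‖ ^ 2 with hsdef
  set a := inner ℂ y v
  set b := inner ℂ z v / (1 - inner ℂ z y) with hb
  -- Clearing the denominator turns `b` into a fixed-point equation. Cauchy–Schwarz with `‖z‖ < 1`
  -- then gives `‖b‖ ≤ ‖v + b y‖`, whose square, expanded and divided by `s`, is the claim.
  have hb' : b = inner ℂ z (v + b • y) := by
    have := one_sub_inner_ne_zero hz hy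
    rw [inner_add_right, inner_smul_right]
    have : b * (1 - inner ℂ z y) = inner ℂ z v := div_mul_cancel₀ _ this
    linear_combination this
  have hle : ‖b‖ ≤ ‖v + b • y‖ := by
    calc ‖b‖ = ‖inner ℂ z (v + b • y)‖ := congrArg norm hb'
      _ ≤ ‖z‖ * ‖v + b • y‖ := norm_inner_le_norm _ _
      _ ≤ 1 * ‖v + b • y‖ := by gcongr
      _ = _ := one_mul _
  have hsq : ‖b‖ ^ 2 ≤ ‖v + b • y‖ ^ 2 := by gcongr
  have hexp : ‖v + b • y‖ ^ 2 = ‖v‖ ^ 2 + 2 * (a.re * b.re + a.im * b.im) + ‖b‖ ^ 2 * ‖y‖ ^ 2 := by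
    rw [norm_add_sq (𝕜 := ℂ), inner_smul_right, ← inner_conj_symm, norm_smul]
    change _ + 2 * (b * conj a).re + _ = _
    simp only [Complex.mul_re, Complex.conj_re, Complex.conj_im]
    ring
  have hform : hypForm y v v = ‖v‖ ^ 2 / s + ‖a‖ ^ 2 / s ^ 2 := by
    rw [hypForm_apply, ← reInner_apply, reInner_self, ← inner_conj_symm]
    change _ + (conj a * a).re / _ = _
    rw [← Complex.normSq_eq_conj_mul_self, Complex.ofReal_re, Complex.normSq_eq_norm_sq]
  have hdiff : ‖a / (s : ℂ) - b‖ ^ 2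
      = ‖a‖ ^ 2 / s ^ 2 - 2 * (a.re * b.re + a.im * b.im) / s + ‖b‖ ^ 2 := by
    rw [← Complex.normSq_eq_norm_sq, ← Complex.normSq_eq_norm_sq, ← Complex.normSq_eq_norm_sq,
      Complex.normSq_apply, Complex.normSq_apply, Complex.normSq_apply]
    simp only [Complex.sub_re, Complex.sub_im, Complex.div_ofReal_re, Complex.div_ofReal_im]
    field_simp
    ring
  rw [hform, hdiff]
  have : s * ‖b‖ ^ 2 ≤ ‖v‖ ^ 2 + 2 * (a.re * b.re + a.im * b.im) := by
    rw [hsdef]; nlinarith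
  have h3 : ‖b‖ ^ 2 ≤ (‖v‖ ^ 2 + 2 * (a.re * b.re + a.im * b.im)) / s := by
    rw [le_div_iff₀ hs]; linarith
  rw [add_div] at h3
  linarith

lemma hypForm_self_pos {z : E} (hz : ‖z‖ < 1) {u : E} (hu : u ≠ 0) : 0 < hypForm z u u := by
  rw [hypForm_apply, ← reInner_apply, reInner_self, ← inner_conj_symm,
    ← Complex.normSq_eq_conj_mul_self, Complex.ofReal_re]
  have := one_sub_norm_sq_pos hz
  have hu' : 0 < ‖u‖ := norm_pos_iff.2 hu
  have := Complex.normSq_nonneg (inner ℂ z u)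
  positivity

lemma hypForm_symm (z u v : E) : hypForm z u v = hypForm z v u := by
  rw [hypForm_apply, hypForm_apply, ← inner_conj_symm u v, ← inner_conj_symm u z,
    ← inner_conj_symm v z, Complex.conj_re]
  simp only [Complex.mul_re, Complex.conj_re, Complex.conj_im]
  ring

end Calculus

/-! ### The hyperbolic diastasis and its maximal gradient. -/

section Diastasis

variable {n : ℕ}

lemma inner_self_eq_ofReal {E : Type*} [NormedAddCommGroup E] [InnerProductSpace ℂ E] (z : E) :
    inner ℂ z z = ((‖z‖ ^ 2 : ℝ) : ℂ) := by
  rw [inner_self_eq_norm_sq_to_K]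
  push_cast
  rfl

lemma CH.norm_lt (z : CH n) : ‖(z : EuclideanSpace ℂ (Fin n))‖ < 1 := mem_ball_zero_iff.1 z.2

lemma isPosDef_hypMetric (n : ℕ) : IsPosDef (hypMetric n) where
  symm _ _ _ := hypForm_symm _ _ _
  pos x _ hu := hypForm_self_pos x.norm_lt hu

/-- Writes the diastasis as potentials plus a pluriharmonic term in `z`, the form used both for
differentiation and for comparison with Calabi's formula. -/
lemma hypDiastasis_eq (z w : CH n) :
    hypDiastasis n z w = hypPotential (z : EuclideanSpace ℂ (Fin n))
      + hypPotential (w : EuclideanSpace ℂ (Fin n))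
      + 2 * (Complex.log (1 - inner ℂ (w : EuclideanSpace ℂ (Fin n)) z)).re := by
  have hz := (one_sub_norm_sq_pos z.norm_lt).ne'
  have hw := (one_sub_norm_sq_pos w.norm_lt).ne'
  have hi := one_sub_inner_ne_zero z.norm_lt w.norm_lt
  have hn : ‖1 - inner ℂ (w : EuclideanSpace ℂ (Fin n)) z‖
      = ‖1 - inner ℂ (z : EuclideanSpace ℂ (Fin n)) w‖ := by
    rw [← inner_conj_symm, ← Complex.norm_conj]
    simp
  rw [hypDiastasis, hypPotential, hypPotential, Complex.log_re, hn,
    Real.log_div (mul_ne_zero hw hz) (pow_ne_zero 2 (norm_ne_zero_iff.2 hi)),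
    Real.log_mul hw hz, Real.log_pow]
  push_cast
  ring

lemma chart_hypPotential_eventuallyEq (x : CH n) :
    ((fun z : CH n => hypPotential (z : EuclideanSpace ℂ (Fin n))) ∘
      (chartAt (EuclideanSpace ℂ (Fin n)) x).symm) =ᶠ[nhds (x : EuclideanSpace ℂ (Fin n))]
      hypPotential := by
  filter_upwards [(complexBall n).2.mem_nhds x.2] with z hz
  simp only [Function.comp_apply, Opens.coe_chartAt_symm x hz]

lemma isKahlerPotential_hypPotential (n : ℕ) :
    IsKahlerPotential (hypMetric n)
      (fun z : CH n => hypPotential (z : EuclideanSpace ℂ (Fin n))) Set.univ where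
  analytic := by
    refine ContMDiff.contMDiffOn fun z => ?_
    have h : ContDiffAt ℝ ω (hypPotential (E := EuclideanSpace ℂ (Fin n))) z :=
      ((contDiffAt_const.sub (contDiff_norm_sq ℂ).contDiffAt).log
        (one_sub_norm_sq_pos z.norm_lt).ne').neg
    exact h.contMDiffAt.comp z Opens.contMDiff_val.contMDiffAt
  potential x _ u v := by
    have h := chart_hypPotential_eventuallyEq x
    rw [halfIDdbar, Opens.chartAt_apply, h.fderiv.fderiv_eq]
    exact hypForm_I_smul x.norm_lt u v

/-- The sesquiholomorphic extension of the hyperbolic potential. -/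
def hypContinuation (n : ℕ) (x y : CH n) : ℂ :=
  -Complex.log (1 - inner ℂ (y : EuclideanSpace ℂ (Fin n)) x)

/-- Hermitian symmetry reduces antiholomorphy in the second variable to holomorphy in the first; off
the cut the principal logarithm commutes with conjugation. -/
lemma conj_hypContinuation (x y : CH n) :
    conj (hypContinuation n x y) = hypContinuation n y x := by
  rw [hypContinuation, hypContinuation, map_neg, ← inner_conj_symm (y : EuclideanSpace ℂ (Fin n)) x,
    ← Complex.log_conj]
  · simp
  · rw [inner_conj_symm]
    exact Complex.slitPlane_arg_ne_pi (one_sub_inner_mem_slitPlane y.norm_lt x.norm_lt)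

lemma mdifferentiable_hypContinuation_left (y : CH n) :
    MDifferentiable 𝓘(ℂ, EuclideanSpace ℂ (Fin n)) 𝓘(ℂ, ℂ) fun x => hypContinuation n x y :=
  fun x => (hasFDerivAt_log_one_sub_inner y.norm_lt
    x.norm_lt).neg.differentiableAt.mdifferentiableAt.comp x
    ((contMDiff_subtype_val (n := 1)).contMDiffAt.mdifferentiableAt one_ne_zero)

lemma isSesquiContinuation_hypContinuation (n : ℕ) :
    IsSesquiContinuation (EuclideanSpace ℂ (Fin n))
      (fun z : CH n => hypPotential (z : EuclideanSpace ℂ (Fin n))) (hypContinuation n)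
      Set.univ where
  holo_left y _ := (mdifferentiable_hypContinuation_left y).mdifferentiableOn
  antiholo_right x _ := by
    simp_rw [conj_hypContinuation]
    exact (mdifferentiable_hypContinuation_left x).mdifferentiableOn
  diag x _ := by
    rw [hypContinuation, hypPotential, inner_self_eq_ofReal, Complex.ofReal_neg,
      Complex.ofReal_log (one_sub_norm_sq_pos x.norm_lt).le, Complex.ofReal_sub, Complex.ofReal_one]

lemma contDiffAt_hypDiastasis {E : Type*} [NormedAddCommGroup E] [InnerProductSpace ℂ E]
    {p : E × E} (hp₁ : ‖p.1‖ < 1) (hp₂ : ‖p.2‖ < 1) :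
    ContDiffAt ℝ ω (fun q : E × E =>
      -Real.log ((1 - ‖q.2‖ ^ 2) * (1 - ‖q.1‖ ^ 2) / ‖1 - inner ℂ q.1 q.2‖ ^ 2)) p := by
  have h1 := (one_sub_norm_sq_pos hp₁).ne'
  have h2 := (one_sub_norm_sq_pos hp₂).ne'
  have h3 := pow_ne_zero 2 (norm_ne_zero_iff.2 (one_sub_inner_ne_zero hp₁ hp₂))
  have hnum : ContDiff ℝ ω (fun q : E × E => (1 - ‖q.2‖ ^ 2) * (1 - ‖q.1‖ ^ 2)) :=
    (contDiff_const.sub (contDiff_snd.norm_sq ℂ)).mul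
      (contDiff_const.sub (contDiff_fst.norm_sq ℂ))
  have hden : ContDiff ℝ ω (fun q : E × E => ‖1 - inner ℂ q.1 q.2‖ ^ 2) :=
    (contDiff_const.sub (contDiff_fst.inner ℂ contDiff_snd)).norm_sq ℝ
  exact ((hnum.contDiffAt.div hden.contDiffAt h3).log (div_ne_zero (mul_ne_zero h2 h1) h3)).neg

lemma contMDiff_hypDiastasis (n : ℕ) :
    ContMDiff (𝓘(ℝ, EuclideanSpace ℂ (Fin n)).prod 𝓘(ℝ, EuclideanSpace ℂ (Fin n))) 𝓘(ℝ, ℝ) ω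
      (fun p : CH n × CH n => hypDiastasis n p.1 p.2) := by
  intro p
  have hv : ContMDiff (𝓘(ℝ, EuclideanSpace ℂ (Fin n)).prod 𝓘(ℝ, EuclideanSpace ℂ (Fin n)))
      𝓘(ℝ, EuclideanSpace ℂ (Fin n) × EuclideanSpace ℂ (Fin n)) ω
      (fun p : CH n × CH n =>
        ((p.1 : EuclideanSpace ℂ (Fin n)), (p.2 : EuclideanSpace ℂ (Fin n)))) :=
    (Opens.contMDiff_val.comp contMDiff_fst).prodMk_space (Opens.contMDiff_val.comp contMDiff_snd)
  have hF := (contDiffAt_hypDiastasis (p := ((p.1 : EuclideanSpace ℂ (Fin n)),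
    (p.2 : EuclideanSpace ℂ (Fin n)))) p.1.norm_lt p.2.norm_lt).contMDiffAt
  have h := ContMDiffAt.comp (f := fun p : CH n × CH n =>
    ((p.1 : EuclideanSpace ℂ (Fin n)), (p.2 : EuclideanSpace ℂ (Fin n)))) p hF hv.contMDiffAt
  exact h

lemma isGlobalDiastasis_hypDiastasis (n : ℕ) :
    IsGlobalDiastasis (hypMetric n) (hypDiastasis n) where
  analytic := contMDiff_hypDiastasis n
  locally_calabi _ := ⟨Set.univ, _, hypContinuation n, isOpen_univ, trivial,
    isKahlerPotential_hypPotential n, isSesquiContinuation_hypContinuation n, fun z _ w _ => by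
      have hd := isSesquiContinuation_hypContinuation n
      rw [hd.diag z trivial, hd.diag w trivial, ← conj_hypContinuation z w, hypDiastasis_eq,
        sub_sub, Complex.add_conj, hypContinuation, Complex.neg_re]
      push_cast
      ring⟩

lemma differential_hypDiastasis (z w : CH n) (v : EuclideanSpace ℂ (Fin n)) :
    differential (fun x => hypDiastasis n x w) z v =
      2 * (inner ℂ (z : EuclideanSpace ℂ (Fin n)) v / (1 - ‖(z : EuclideanSpace ℂ (Fin n))‖ ^ 2 : ℝ)
        - inner ℂ (w : EuclideanSpace ℂ (Fin n)) v
          / (1 - inner ℂ (w : EuclideanSpace ℂ (Fin n)) z)).re := by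
  have hlog := ((Complex.reCLM.hasFDerivAt.comp (z : EuclideanSpace ℂ (Fin n))
    ((hasFDerivAt_log_one_sub_inner w.norm_lt z.norm_lt).restrictScalars ℝ)).const_mul 2)
  have h := Opens.hasMFDerivAt_comp_val (((hasFDerivAt_hypPotential z.norm_lt).add_const
    (hypPotential (w : EuclideanSpace ℂ (Fin n)))).add hlog)
  have he : (fun x => hypDiastasis n x w) = fun y : CH n =>
      hypPotential (y : EuclideanSpace ℂ (Fin n)) + hypPotential (w : EuclideanSpace ℂ (Fin n))
      + 2 * (Complex.log (1 - inner ℂ (w : EuclideanSpace ℂ (Fin n)) y)).re :=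
    funext fun y => hypDiastasis_eq y w
  rw [he, differential]
  refine (DFunLike.congr_fun h.mfderiv v).trans ?_
  rw [Complex.sub_re, Complex.div_ofReal_re, mul_sub]
  change 2 * (_)⁻¹ * (inner ℂ (z : EuclideanSpace ℂ (Fin n)) v).re
    + 2 * ((1 - inner ℂ (w : EuclideanSpace ℂ (Fin n)) z)⁻¹
      * -inner ℂ (w : EuclideanSpace ℂ (Fin n)) v).re = _
  rw [mul_neg, Complex.neg_re, div_eq_inv_mul (inner ℂ (w : EuclideanSpace ℂ (Fin n)) v)]
  ring

lemma gradSup_hypDiastasis_le (n : ℕ) : gradSup (hypMetric n) (hypDiastasis n) ≤ 2 := by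
  refine iSup₂_le fun y z => ?_
  refine ((isPosDef_hypMetric n).tangentNorm_gradient_le _ y zero_le_two fun v => ?_).trans_eq
    (ENNReal.ofReal_ofNat 2)
  rw [differential_hypDiastasis]
  gcongr
  exact (Complex.re_le_norm _).trans
    (Real.le_sqrt_of_sq_le (sq_norm_differential_le y.norm_lt z.norm_lt v))

/-- The origin of complex hyperbolic space. -/
def CH.origin (n : ℕ) : CH n := ⟨0, by simp [complexBall]⟩

/-- Take base point 0 and a point `y` of norm `r` on a coordinate axis. Pairing the gradient with
the radial vector `y` gives, by Cauchy–Schwarz, a norm of at least `2r`, and `r` can approach 1. A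
nonzero vector is needed, hence `n ≠ 0`. -/
lemma gradSup_hypDiastasis (n : ℕ) (hn : n ≠ 0) :
    gradSup (hypMetric n) (hypDiastasis n) = 2 := by
  refine le_antisymm (gradSup_hypDiastasis_le n) (le_of_forall_lt fun a ha => ?_)
  lift a to NNReal using ha.ne_top
  have ha2 : (a : ℝ) < 2 := by exact_mod_cast ha
  obtain ⟨r, hr0, hr1⟩ := exists_between (show (a : ℝ) / 2 < 1 by linarith)
  have hr : 0 < r := lt_of_le_of_lt (by positivity) hr0
  have : NeZero n := ⟨hn⟩
  let y : CH n := ⟨EuclideanSpace.single 0 (r : ℂ), by simp [complexBall, abs_of_pos hr, hr1]⟩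
  have hy : ‖(y : EuclideanSpace ℂ (Fin n))‖ = r := by simp [y, abs_of_pos hr]
  have hg := isPosDef_hypMetric n
  have hs : 0 < 1 - r ^ 2 := by nlinarith
  refine lt_of_lt_of_le ?_ (le_iSup₂ (f := fun y z => tangentNorm (hypMetric n) y
    (gradient (hypMetric n) (fun x => hypDiastasis n x z) y)) y (CH.origin n))
  have hcs := hg.abs_apply_le y (gradient (hypMetric n)
    (fun x => hypDiastasis n x (CH.origin n)) y) y
  have hform : hypMetric n y y y = (r / (1 - r ^ 2)) ^ 2 := by
    change hypForm _ _ _ = _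
    rw [hypForm_apply, inner_self_eq_ofReal, hy, ← Complex.ofReal_mul, Complex.ofReal_re,
      Complex.ofReal_re]
    field_simp
    ring
  have hval : hypMetric n y (gradient (hypMetric n)
      (fun x => hypDiastasis n x (CH.origin n)) y) y = 2 * (r ^ 2 / (1 - r ^ 2)) := by
    rw [hg.gradient_apply, differential_hypDiastasis, inner_self_eq_ofReal, hy]
    simp only [CH.origin, inner_zero_left, zero_div, sub_zero, Complex.div_ofReal_re,
      Complex.ofReal_re]
  rw [hval, hform, Real.sqrt_sq (by positivity), abs_of_pos (by positivity)] at hcs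
  rw [tangentNorm, ← ENNReal.ofReal_coe_nnreal, ENNReal.ofReal_lt_ofReal_iff']
  have h2r : 2 * r ≤ √(hypMetric n y (gradient (hypMetric n)
      (fun x => hypDiastasis n x (CH.origin n)) y) (gradient (hypMetric n)
      (fun x => hypDiastasis n x (CH.origin n)) y)) := by
    refine le_of_mul_le_mul_right (le_trans (le_of_eq ?_) hcs)
      (show 0 < r / (1 - r ^ 2) by positivity)
    ring
  constructor <;> linarith

end Diastasis

/-! ### Convergence of the radial integral. -/

section OneDim

lemma integrableOn_one_sub_rpow_iff {p : ℝ} :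
    IntegrableOn (fun y : ℝ => (1 - y) ^ p) (Set.Ioo 0 1) ↔ -1 < p := by
  rw [← intervalIntegral.integrableOn_Ioo_rpow_iff (s := p) one_pos]
  have h := (Measure.measurePreserving_sub_left (volume : Measure ℝ) 1).integrableOn_comp_preimage
    (MeasurableEquiv.subLeft (1 : ℝ)).measurableEmbedding (f := fun y : ℝ => y ^ p)
    (s := Set.Ioo 0 1)
  simpa [Function.comp_def] using h

lemma one_add_rpow_le {y : ℝ} (h0 : 0 ≤ y) (h1 : y ≤ 1) (p : ℝ) : (1 + y) ^ p ≤ 2 ^ |p| :=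
  (Real.rpow_le_rpow_of_exponent_le (by linarith) (le_abs_self p)).trans
    (Real.rpow_le_rpow (by linarith) (by linarith) (abs_nonneg p))

/-- Only the endpoint 1 matters: in `(1 - y²)^p = (1 + y)^p (1 - y)^p` the first factor is bounded
above and below on the interval. -/
lemma integrableOn_pow_mul_one_sub_sq_rpow_iff {k : ℕ} {p : ℝ} :
    IntegrableOn (fun y : ℝ => y ^ k * (1 - y ^ 2) ^ p) (Set.Ioo 0 1) ↔ -1 < p := by
  have split : ∀ y ∈ Set.Ioo (0 : ℝ) 1, (1 - y ^ 2) ^ p = (1 + y) ^ p * (1 - y) ^ p := by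
    intro y hy
    rw [← Real.mul_rpow (by linarith [hy.1]) (by linarith [hy.2])]
    ring_nf
  have meas : Measurable fun y : ℝ => y ^ k * (1 - y ^ 2) ^ p := by fun_prop
  constructor
  · intro h
    rw [← integrableOn_one_sub_rpow_iff]
    -- The additive constant controls `y ≤ 1/2`, where `y ^ k` may vanish; the multiple of the
    -- integrand controls `y > 1/2`.
    have hdom : IntegrableOn
        (fun y : ℝ => 2 ^ k * 2 ^ |p| * (y ^ k * (1 - y ^ 2) ^ p) + 2 ^ |p|) (Set.Ioo 0 1) :=
      (h.const_mul _).add (integrableOn_const (by simp))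
    refine hdom.mono' (Measurable.aestronglyMeasurable (by fun_prop)) ?_
    filter_upwards [ae_restrict_mem measurableSet_Ioo] with y hy
    have h0 : (0 : ℝ) < 1 - y := by linarith [hy.2]
    have hq : (0 : ℝ) < (1 - y) ^ p := Real.rpow_pos_of_pos h0 p
    have h2 : (0 : ℝ) < 2 ^ |p| := by positivity
    rw [Real.norm_of_nonneg hq.le]
    rcases le_or_gt y (1 / 2) with hle | hlt
    · have hF : 0 ≤ 2 ^ k * 2 ^ |p| * (y ^ k * (1 - y ^ 2) ^ p) := by
        have := hy.1
        have : 0 ≤ 1 - y ^ 2 := by nlinarith [hy.2]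
        positivity
      have : (1 - y) ^ p ≤ 2 ^ |p| := by
        calc (1 - y) ^ p ≤ (1 - y) ^ (-|p|) :=
              Real.rpow_le_rpow_of_exponent_ge h0 (by linarith [hy.1]) (neg_abs_le p)
          _ = ((1 - y)⁻¹) ^ |p| := by rw [Real.rpow_neg h0.le, Real.inv_rpow h0.le]
          _ ≤ 2 ^ |p| := by
              refine Real.rpow_le_rpow (by positivity) ?_ (abs_nonneg p)
              rw [inv_le_comm₀ h0 two_pos]
              linarith
      linarith
    · rw [split y hy]
      have hk : 1 ≤ 2 ^ k * y ^ k := by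
        rw [← mul_pow]
        exact one_le_pow₀ (by linarith)
      have hp : 1 ≤ 2 ^ |p| * (1 + y) ^ p := by
        have hinv : (1 + y) ^ (-p) ≤ 2 ^ |p| := by
          simpa using one_add_rpow_le hy.1.le hy.2.le (-p)
        calc (1 : ℝ) = (1 + y) ^ (-p) * (1 + y) ^ p := by
              rw [← Real.rpow_add (by linarith [hy.1])]; simp
          _ ≤ _ := by
              have : 0 ≤ (1 + y) ^ p := Real.rpow_nonneg (by linarith [hy.1]) p
              gcongr
      have := mul_le_mul hk hp zero_le_one (by linarith)
      nlinarith
  · intro h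
    refine ((integrableOn_one_sub_rpow_iff.2 h).const_mul (2 ^ |p|)).mono'
      meas.aestronglyMeasurable ?_
    filter_upwards [ae_restrict_mem measurableSet_Ioo] with y hy
    have hq : 0 ≤ (1 - y) ^ p := Real.rpow_nonneg (by linarith [hy.2]) p
    have hr : 0 ≤ (1 + y) ^ p := Real.rpow_nonneg (by linarith [hy.1]) p
    have hk : y ^ k ≤ 1 := pow_le_one₀ hy.1.le hy.2.le
    have hk0 : 0 ≤ y ^ k := pow_nonneg hy.1.le k
    rw [split y hy, Real.norm_of_nonneg (by positivity), ← mul_assoc]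
    refine mul_le_mul_of_nonneg_right ?_ hq
    calc y ^ k * (1 + y) ^ p ≤ 1 * 2 ^ |p| :=
          mul_le_mul hk (one_add_rpow_le hy.1.le hy.2.le p) hr zero_le_one
      _ = _ := one_mul _

end OneDim

/-! ### The hyperbolic volume and its integrals. -/

section Volume

lemma det_hypForm {E : Type*} [NormedAddCommGroup E] [InnerProductSpace ℂ E]
    [FiniteDimensional ℂ E] {z : E} (hz : ‖z‖ < 1) :
    letI : InnerProductSpace ℝ E := InnerProductSpace.rclikeToReal ℂ E
    Matrix.det (Matrix.of fun i j =>
      hypForm z (stdOrthonormalBasis ℝ E i) (stdOrthonormalBasis ℝ E j))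
      = (((1 - ‖z‖ ^ 2) ^ (Module.finrank ℂ E + 1))⁻¹) ^ 2 := by
  let : InnerProductSpace ℝ E := InnerProductSpace.rclikeToReal ℂ E
  have hs := one_sub_norm_sq_pos hz
  set s := 1 - ‖z‖ ^ 2 with hsdef
  let b := stdOrthonormalBasis ℝ E
  let v : Fin 2 → E := ![z, Complex.I • z]
  let A : Matrix (Fin (Module.finrank ℝ E)) (Fin 2) ℝ := Matrix.of fun i k => reInner (v k) (b i)
  have hcoe : ∀ u w : E, reInner u w = inner ℝ u w := fun _ _ => rfl
  have hpars : ∀ k l, ∑ i, A i k * A i l = reInner (v k) (v l) := by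
    intro k l
    have := b.sum_inner_mul_inner (v k) (v l)
    rw [hcoe, ← this]
    refine Finset.sum_congr rfl fun i _ => ?_
    simp only [A, Matrix.of_apply, hcoe]
    rw [real_inner_comm (b i) (v l)]
  -- The metric is a multiple of the identity plus a perturbation spanned by `z` and `i z`. The
  -- identity `det (1 + AB) = det (1 + BA)` reduces the determinant to a 2 × 2 one, diagonal because
  -- `z ⊥ i z`.
  have hM : (Matrix.of fun i j => hypForm z (b i) (b j)) = s⁻¹ • (1 + A * (s⁻¹ • A.transpose)) := by
    ext i j
    have h1 : reInner (b i) (b j) = (1 : Matrix _ _ ℝ) i j := by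
      rw [hcoe, OrthonormalBasis.inner_eq_ite, Matrix.one_apply]
    rw [Matrix.of_apply, hypForm_apply, ← reInner_apply, h1, ← hsdef]
    simp only [Matrix.smul_apply, Matrix.add_apply, Matrix.mul_apply, Fin.sum_univ_two, A, v,
      Matrix.of_apply, Matrix.transpose_apply, Matrix.cons_val_zero, Matrix.cons_val_one,
      reInner_apply, inner_smul_left, Complex.conj_I, smul_eq_mul, ← inner_conj_symm (b i) z,
      Complex.mul_re, Complex.neg_re, Complex.neg_im, Complex.I_re, Complex.I_im, Complex.conj_re,
      Complex.conj_im]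
    field_simp
    ring
  have hBA : (1 + (s⁻¹ • A.transpose) * A) = s⁻¹ • (1 : Matrix (Fin 2) (Fin 2) ℝ) := by
    have h0 : reInner z (Complex.I • z) = 0 := by
      rw [reInner_apply, inner_smul_right, inner_self_eq_ofReal, Complex.re_mul_ofReal,
        Complex.I_re, zero_mul]
    have h0' : reInner (Complex.I • z) z = 0 := by
      rw [reInner_apply, inner_smul_left, inner_self_eq_ofReal, Complex.re_mul_ofReal,
        Complex.conj_re, Complex.I_re, zero_mul]
    have h1 : reInner (Complex.I • z) (Complex.I • z) = ‖z‖ ^ 2 := by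
      rw [reInner_self, norm_smul]; simp
    have hz2 : 1 + s⁻¹ * ‖z‖ ^ 2 = s⁻¹ := by
      field_simp
      rw [hsdef]; ring
    ext k l
    have : ((s⁻¹ • A.transpose) * A) k l = s⁻¹ * reInner (v k) (v l) := by
      rw [← hpars, Finset.mul_sum, Matrix.mul_apply]
      simp [mul_assoc]
    rw [Matrix.add_apply, this]
    fin_cases k <;> fin_cases l <;> simp [v, h0, h0', h1, reInner_self, hz2]
  change Matrix.det (Matrix.of fun i j => hypForm z (b i) (b j)) = _
  have hdim : Module.finrank ℝ E = 2 * Module.finrank ℂ E := finrank_real_of_complex E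
  rw [hM, Matrix.det_smul, Matrix.det_one_add_mul_comm, hBA, Matrix.det_smul, Fintype.card_fin,
    Fintype.card_fin, Matrix.det_one, hdim]
  rw [mul_one, ← pow_add, inv_pow, inv_pow, ← pow_mul]
  ring_nf

variable {n : ℕ}

lemma volumeDensity_hypMetric (x : CH n) {z : EuclideanSpace ℂ (Fin n)}
    (hz : z ∈ complexBall n) :
    volumeDensity (hypMetric n) (chartAt (EuclideanSpace ℂ (Fin n)) x) z
      = ((1 - ‖z‖ ^ 2) ^ (n + 1))⁻¹ := by
  have hz1 : ‖z‖ < 1 := mem_ball_zero_iff.1 hz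
  have hs := one_sub_norm_sq_pos hz1
  rw [volumeDensity]
  simp only [Opens.chartMetric_chartAt _ x hz]
  have h := det_hypForm hz1
  rw [finrank_euclideanSpace_fin] at h
  exact (congrArg Real.sqrt h).trans (Real.sqrt_sq (by positivity))

/-- Integration against the volume of complex hyperbolic space, in the ball. -/
lemma exists_lintegral_riemannianVolume_hypMetric (n : ℕ) :
    ∃ μ : Measure (EuclideanSpace ℂ (Fin n)), μ.IsAddHaarMeasure ∧
      ∀ f : EuclideanSpace ℂ (Fin n) → ℝ≥0∞, Measurable f →
        ∫⁻ x : CH n, f x ∂(riemannianVolume (hypMetric n)) =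
          ∫⁻ z in Metric.ball 0 1, ENNReal.ofReal ((1 - ‖z‖ ^ 2) ^ (n + 1))⁻¹ * f z ∂μ := by
  let : InnerProductSpace ℝ (EuclideanSpace ℂ (Fin n)) := InnerProductSpace.rclikeToReal ℂ _
  let μ : Measure (EuclideanSpace ℂ (Fin n)) :=
    (measureSpaceOfInnerProductSpace (E := EuclideanSpace ℂ (Fin n))).volume
  refine ⟨μ, by dsimp only [μ]; infer_instance, fun f hf => ?_⟩
  let e := chartAt (EuclideanSpace ℂ (Fin n)) (CH.origin n)
  have het : e.target = Metric.ball 0 1 := Opens.chartAt_target _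
  have hvol : riemannianVolume (hypMetric n) = Measure.map e.symm
      ((μ.restrict (Metric.ball 0 1)).withDensity
        fun z => ENNReal.ofReal (volumeDensity (hypMetric n) e z)) := by
    rw [← het]
    refine le_antisymm (iSup₂_le fun e' he' => ?_)
      (le_iSup₂_of_le e (chart_mem_atlas _ _) le_rfl)
    rw [Opens.eq_chartAt (CH.origin n) he']
  have hdens : (μ.restrict (Metric.ball 0 1)).withDensity
        (fun z => ENNReal.ofReal (volumeDensity (hypMetric n) e z)) =
      (μ.restrict (Metric.ball 0 1)).withDensity
        (fun z => ENNReal.ofReal ((1 - ‖z‖ ^ 2) ^ (n + 1))⁻¹) := by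
    refine withDensity_congr_ae ?_
    filter_upwards [ae_restrict_mem Metric.isOpen_ball.measurableSet] with z hz
    rw [volumeDensity_hypMetric _ hz]
  have hsymm : AEMeasurable e.symm (μ.restrict (Metric.ball 0 1)) := by
    have := e.continuousOn_symm
    rw [het] at this
    exact this.aemeasurable Metric.isOpen_ball.measurableSet
  rw [hvol, hdens, lintegral_map' (f := fun x : CH n => f x)
    (hf.comp measurable_subtype_coe).aemeasurable (hsymm.mono_ac (withDensity_absolutelyContinuous _ _)),
    lintegral_withDensity_eq_lintegral_mul₀' (by fun_prop) ?_]
  · refine setLIntegral_congr_fun Metric.isOpen_ball.measurableSet fun z hz => ?_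
    simp only [Pi.mul_apply, e, Opens.coe_chartAt_symm (CH.origin n) hz]
  · exact ((hf.comp measurable_subtype_coe).comp_aemeasurable hsymm).mono_ac
      (withDensity_absolutelyContinuous _ _)

/-- The density lowers the exponent by `n + 1`. Being a Haar measure is all that polar coordinates
ask of `μ`. -/
lemma lintegral_one_sub_norm_sq_rpow (n : ℕ) :
    ∃ μ : Measure (EuclideanSpace ℂ (Fin n)), μ.IsAddHaarMeasure ∧ ∀ c : ℝ,
        ∫⁻ x : CH n, ENNReal.ofReal ((1 - ‖(x : EuclideanSpace ℂ (Fin n))‖ ^ 2) ^ c)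
            ∂(riemannianVolume (hypMetric n)) =
          ∫⁻ z in Metric.ball 0 1, ENNReal.ofReal ((1 - ‖z‖ ^ 2) ^ (c - n - 1)) ∂μ := by
  obtain ⟨μ, hμ, h⟩ := exists_lintegral_riemannianVolume_hypMetric n
  refine ⟨μ, hμ, fun c => ?_⟩
  rw [h (fun z => ENNReal.ofReal ((1 - ‖z‖ ^ 2) ^ c)) (by fun_prop)]
  refine setLIntegral_congr_fun Metric.isOpen_ball.measurableSet fun z hz => ?_
  have hs := one_sub_norm_sq_pos (mem_ball_zero_iff.1 hz)
  rw [← ENNReal.ofReal_mul (by positivity), show c - n - 1 = -((n + 1 : ℕ) : ℝ) + c by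
    push_cast; ring, Real.rpow_add hs, Real.rpow_neg hs.le, Real.rpow_natCast]

/-- The integral of `(1 - ‖x‖²)^c` over complex hyperbolic space of positive dimension is finite
if and only if `c > n`. -/
lemma lintegral_one_sub_norm_sq_rpow_lt_top_iff (hn : n ≠ 0) (c : ℝ) :
    ∫⁻ x : CH n, ENNReal.ofReal ((1 - ‖(x : EuclideanSpace ℂ (Fin n))‖ ^ 2) ^ c)
      ∂(riemannianVolume (hypMetric n)) < ⊤ ↔ n < c := by
  obtain ⟨μ, hμ, h⟩ := lintegral_one_sub_norm_sq_rpow n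
  have : NeZero n := ⟨hn⟩
  have : Nontrivial (EuclideanSpace ℂ (Fin n)) := inferInstance
  have hmeas : Measurable fun z : EuclideanSpace ℂ (Fin n) => (1 - ‖z‖ ^ 2) ^ (c - n - 1) := by
    fun_prop
  rw [h, lt_top_iff_ne_top, lintegral_ofReal_ne_top_iff_integrable hmeas.aestronglyMeasurable]
  -- Polar coordinates leave a power of `r` times `(1 - r²)^{c-n-1}`; the critical exponent `-1`
  -- corresponds to `c = n`.
  · refine (integrableOn_fun_norm_addHaar μ (f := fun r : ℝ => (1 - r ^ 2) ^ (c - n - 1))).trans ?_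
    simp only [smul_eq_mul]
    rw [integrableOn_pow_mul_one_sub_sq_rpow_iff]
    constructor <;> intro <;> linarith
  · filter_upwards [ae_restrict_mem Metric.isOpen_ball.measurableSet] with z hz
    exact Real.rpow_nonneg (one_sub_norm_sq_pos (mem_ball_zero_iff.1 hz)).le _

lemma lintegral_one_sub_norm_sq_rpow_lt_top {c : ℝ} (hc : n < c) :
    ∫⁻ x : CH n, ENNReal.ofReal ((1 - ‖(x : EuclideanSpace ℂ (Fin n))‖ ^ 2) ^ c)
      ∂(riemannianVolume (hypMetric n)) < ⊤ := by
  rcases eq_or_ne n 0 with rfl | hn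
  · obtain ⟨μ, hμ, h⟩ := lintegral_one_sub_norm_sq_rpow 0
    rw [h]
    have : ∀ z : EuclideanSpace ℂ (Fin 0), ‖z‖ = 0 := fun z => by
      rw [Subsingleton.elim z 0, norm_zero]
    simp [this]
  · exact (lintegral_one_sub_norm_sq_rpow_lt_top_iff hn c).2 hc

/-- In dimension 0 the integral is finite for every `c`, so there the bound comes from `0 ≤ c`
alone. -/
lemma le_of_lintegral_one_sub_norm_sq_rpow_lt_top {c : ℝ} (hc : 0 ≤ c)
    (h : ∫⁻ x : CH n, ENNReal.ofReal ((1 - ‖(x : EuclideanSpace ℂ (Fin n))‖ ^ 2) ^ c)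
      ∂(riemannianVolume (hypMetric n)) < ⊤) : n ≤ c := by
  rcases eq_or_ne n 0 with rfl | hn
  · simpa using hc
  · exact ((lintegral_one_sub_norm_sq_rpow_lt_top_iff hn c).1 h).le

end Volume

/-! ### An upper bound of the hyperbolic distance from radial paths. -/

section Distance

variable {n : ℕ}

lemma hypForm_smul_self {E : Type*} [NormedAddCommGroup E] [InnerProductSpace ℂ E] {x : E} {t : ℝ}
    (h : ‖t • x‖ < 1) : hypForm (t • x) x x = (‖x‖ / (1 - t ^ 2 * ‖x‖ ^ 2)) ^ 2 := by
  have hn : ‖t • x‖ ^ 2 = t ^ 2 * ‖x‖ ^ 2 := by rw [norm_smul, mul_pow, Real.norm_eq_abs, sq_abs]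
  have hs := one_sub_norm_sq_pos h
  rw [hn] at hs
  have hi : inner ℂ x (t • x) * inner ℂ (t • x) x = ((t ^ 2 * (‖x‖ ^ 2) ^ 2 : ℝ) : ℂ) := by
    rw [← Complex.coe_smul, inner_smul_left, inner_smul_right, inner_self_eq_ofReal,
      Complex.conj_ofReal]
    push_cast
    ring
  rw [hypForm_apply, hn, hi, inner_self_eq_ofReal, Complex.ofReal_re, Complex.ofReal_re]
  field_simp
  ring

/-- The integral is `artanh r = log (1 + r) - log (1 - r²) / 2`, and `1 + r ≤ 2`. -/
lemma lintegral_radial_speed_le {r : ℝ} (h0 : 0 ≤ r) (h1 : r < 1) :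
    ∫⁻ t in Set.Icc (0 : ℝ) 1, ENNReal.ofReal (r / (1 - t ^ 2 * r ^ 2)) ≤
      ENNReal.ofReal (Real.log 2 - Real.log (1 - r ^ 2) / 2) := by
  have hpos : ∀ t ∈ Set.Icc (0 : ℝ) 1, 0 < 1 - t * r ∧ 0 < 1 + t * r := fun t ht => by
    constructor <;> nlinarith [ht.1, ht.2, mul_nonneg ht.1 h0]
  have hden : ∀ t ∈ Set.Icc (0 : ℝ) 1, 0 < 1 - t ^ 2 * r ^ 2 := fun t ht => by
    have := mul_pos (hpos t ht).1 (hpos t ht).2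
    nlinarith
  have hcont : ContinuousOn (fun t : ℝ => r / (1 - t ^ 2 * r ^ 2)) (Set.Icc 0 1) :=
    continuousOn_const.div (by fun_prop) fun t ht => (hden t ht).ne'
  have hderiv : ∀ t ∈ Set.uIcc (0 : ℝ) 1,
      HasDerivAt (fun t => (Real.log (1 + t * r) - Real.log (1 - t * r)) / 2)
        (r / (1 - t ^ 2 * r ^ 2)) t := by
    intro t ht
    rw [Set.uIcc_of_le zero_le_one] at ht
    have hp := hpos t ht
    have hd := hden t ht
    have hl : HasDerivAt (fun t : ℝ => t * r) r t := by simpa using (hasDerivAt_id t).mul_const r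
    refine ((((hl.const_add 1).log hp.2.ne').sub ((hl.const_sub 1).log hp.1.ne')).div_const
      2).congr_deriv ?_
    have h1 := hp.1.ne'
    have h2 := hp.2.ne'
    rw [show 1 - t ^ 2 * r ^ 2 = (1 + t * r) * (1 - t * r) by ring]
    rw [neg_div, sub_neg_eq_add, div_add_div _ _ h2 h1, div_div,
      div_eq_div_iff (by positivity) (by positivity)]
    ring
  have hint : IntervalIntegrable (fun t : ℝ => r / (1 - t ^ 2 * r ^ 2)) volume 0 1 :=
    ContinuousOn.intervalIntegrable (by rwa [Set.uIcc_of_le zero_le_one])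
  rw [← ofReal_integral_eq_lintegral_ofReal hcont.integrableOn_Icc
    (by filter_upwards [ae_restrict_mem measurableSet_Icc] with t ht
        exact div_nonneg h0 (hden t ht).le),
    integral_Icc_eq_integral_Ioc, ← intervalIntegral.integral_of_le zero_le_one,
    intervalIntegral.integral_eq_sub_of_hasDerivAt hderiv hint]
  refine ENNReal.ofReal_le_ofReal ?_
  have e1 : Real.log (1 - r ^ 2) = Real.log (1 + r) + Real.log (1 - r) := by
    rw [← Real.log_mul (by linarith) (by linarith)]
    ring_nf
  have e2 : Real.log (1 + r) ≤ Real.log 2 := Real.log_le_log (by linarith) (by linarith)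
  simp only [one_mul, zero_mul, add_zero, sub_zero, Real.log_one, sub_self, zero_div]
  linarith

/-- The radial path from the origin to `x`. -/
def radialPath (x : CH n) (t : ℝ) : CH n :=
  open Classical in
  if h : ‖t • (x : EuclideanSpace ℂ (Fin n))‖ < 1 then
    ⟨t • (x : EuclideanSpace ℂ (Fin n)), mem_ball_zero_iff.2 h⟩ else CH.origin n

lemma norm_smul_lt_one (x : CH n) {t : ℝ} (ht : t ∈ Set.Icc (0 : ℝ) 1) :
    ‖t • (x : EuclideanSpace ℂ (Fin n))‖ < 1 := by
  rw [norm_smul, Real.norm_of_nonneg ht.1]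
  exact (mul_le_of_le_one_left (norm_nonneg _) ht.2).trans_lt x.norm_lt

lemma coe_radialPath (x : CH n) {t : ℝ} (h : ‖t • (x : EuclideanSpace ℂ (Fin n))‖ < 1) :
    (radialPath x t : EuclideanSpace ℂ (Fin n)) = t • (x : EuclideanSpace ℂ (Fin n)) := by
  rw [radialPath, dif_pos h]

/-- The default value of `radialPath` outside the ball is invisible near `[0, 1]`. -/
lemma radialPath_eventuallyEq (x : CH n) {t : ℝ}
    (ht : t ∈ Set.Icc (0 : ℝ) 1) :
    (fun s => (radialPath x s : EuclideanSpace ℂ (Fin n))) =ᶠ[nhds t]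
      fun s => s • (x : EuclideanSpace ℂ (Fin n)) := by
  have hopen : IsOpen {s : ℝ | ‖s • (x : EuclideanSpace ℂ (Fin n))‖ < 1} :=
    isOpen_lt (by fun_prop) continuous_const
  filter_upwards [hopen.mem_nhds (norm_smul_lt_one x ht)] with s hs
  exact coe_radialPath x hs

lemma contMDiffAt_radialPath (x : CH n) {t : ℝ} (ht : t ∈ Set.Icc (0 : ℝ) 1) :
    ContMDiffAt 𝓘(ℝ, ℝ) 𝓘(ℝ, EuclideanSpace ℂ (Fin n)) 1 (radialPath x) t := by
  have h : ContMDiffAt 𝓘(ℝ, ℝ) 𝓘(ℝ, EuclideanSpace ℂ (Fin n)) (⊤ : ℕ∞)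
      (Subtype.val ∘ radialPath x) t :=
    ((contDiff_id.smul contDiff_const).contDiffAt.congr_of_eventuallyEq
      (radialPath_eventuallyEq x ht)).contMDiffAt
  exact ((ContMDiffAt.subtypeVal_comp_iff _ _ _).1 h).of_le (by exact_mod_cast le_top)

lemma geodesicDist_origin_le (x : CH n) :
    geodesicDist (hypMetric n) (CH.origin n) x ≤ ENNReal.ofReal
      (Real.log 2 - Real.log (1 - ‖(x : EuclideanSpace ℂ (Fin n))‖ ^ 2) / 2) := by
  let := tangentENorm (hypMetric n)
  have := tangentENorm_smulClass (hypMetric n)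
  have h0 : radialPath x 0 = CH.origin n :=
    Subtype.ext ((coe_radialPath x (norm_smul_lt_one x (by simp))).trans (zero_smul _ _))
  have h1 : radialPath x 1 = x :=
    Subtype.ext ((coe_radialPath x (norm_smul_lt_one x (by simp))).trans (one_smul _ _))
  rw [geodesicDist_eq]
  refine (Manifold.riemannianEDist_le_pathELength
    (fun t ht => (contMDiffAt_radialPath x ht).contMDiffWithinAt) h0 h1 zero_le_one).trans ?_
  refine le_trans (le_of_eq ?_) (lintegral_radial_speed_le (norm_nonneg _) x.norm_lt)
  rw [Manifold.pathELength_eq_lintegral_mfderiv_Icc]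
  refine setLIntegral_congr_fun measurableSet_Icc fun t ht => ?_
  have hlt := norm_smul_lt_one x ht
  have hd : HasDerivAt (fun s => (radialPath x s : EuclideanSpace ℂ (Fin n)))
      (x : EuclideanSpace ℂ (Fin n)) t := by
    refine HasDerivAt.congr_of_eventuallyEq ?_ (radialPath_eventuallyEq x ht)
    simpa using (hasDerivAt_id t).smul_const (x : EuclideanSpace ℂ (Fin n))
  have hv := Opens.mfderiv_curve ((contMDiffAt_radialPath x ht).mdifferentiableAt one_ne_zero) hd
  have hs := one_sub_norm_sq_pos hlt
  rw [norm_smul, mul_pow, Real.norm_eq_abs, sq_abs] at hs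
  change tangentNorm (hypMetric n) (radialPath x t)
    ((mfderiv 𝓘(ℝ, ℝ) 𝓘(ℝ, EuclideanSpace ℂ (Fin n)) (radialPath x) t :
      ℝ →L[ℝ] EuclideanSpace ℂ (Fin n)) (1 : ℝ)) = _
  rw [hv, tangentNorm, hypMetric, coe_radialPath x hlt, hypForm_smul_self hlt,
    Real.sqrt_sq (by positivity)]

/-- Passing through the origin changes the radial bound only by a constant depending on `w`. -/
lemma exists_geodesicDist_le (w : CH n) : ∃ K : ℝ, ∀ x : CH n,
    geodesicDist (hypMetric n) w x ≤ ENNReal.ofReal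
      (K - Real.log (1 - ‖(x : EuclideanSpace ℂ (Fin n))‖ ^ 2) / 2) := by
  let := tangentENorm (hypMetric n)
  have := tangentENorm_smulClass (hypMetric n)
  have hpos : ∀ x : CH n,
      0 ≤ Real.log 2 - Real.log (1 - ‖(x : EuclideanSpace ℂ (Fin n))‖ ^ 2) / 2 := fun x => by
    have h1 := Real.log_nonpos (one_sub_norm_sq_pos x.norm_lt).le
      (by linarith [sq_nonneg ‖(x : EuclideanSpace ℂ (Fin n))‖])
    have h2 := Real.log_nonneg one_le_two
    linarith
  refine ⟨(Real.log 2 - Real.log (1 - ‖(w : EuclideanSpace ℂ (Fin n))‖ ^ 2) / 2) + Real.log 2,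
    fun x => ?_⟩
  rw [add_sub_assoc, ENNReal.ofReal_add (hpos w) (hpos x)]
  refine le_trans ?_ (add_le_add (geodesicDist_origin_le w) (geodesicDist_origin_le x))
  rw [geodesicDist_eq, geodesicDist_eq, geodesicDist_eq,
    Manifold.riemannianEDist_comm (x := CH.origin n) (y := w)]
  exact Manifold.riemannianEDist_triangle

end Distance

/-! ### The entropies of complex hyperbolic space. -/

section Entropy

variable {n : ℕ}

lemma exp_neg_mul_hypDiastasis (c : ℝ) (x w : CH n) :
    Real.exp (-(c * hypDiastasis n x w)) =
      ((1 - ‖(w : EuclideanSpace ℂ (Fin n))‖ ^ 2)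
        / ‖1 - inner ℂ (x : EuclideanSpace ℂ (Fin n)) w‖ ^ 2) ^ c
        * (1 - ‖(x : EuclideanSpace ℂ (Fin n))‖ ^ 2) ^ c := by
  have hx := one_sub_norm_sq_pos x.norm_lt
  have hw := one_sub_norm_sq_pos w.norm_lt
  have hi : 0 < ‖1 - inner ℂ (x : EuclideanSpace ℂ (Fin n)) w‖ ^ 2 :=
    pow_pos (norm_pos_iff.2 (one_sub_inner_ne_zero x.norm_lt w.norm_lt)) 2
  rw [← Real.mul_rpow (by positivity) hx.le, Real.rpow_def_of_pos (by positivity), hypDiastasis]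
  congr 1
  rw [div_mul_eq_mul_div]
  ring

/-- Together with `le_norm_one_sub_inner` this makes `e^{-c D_w}` comparable to `(1 - ‖x‖²)^c`, with
constants depending on `w` and `c`. -/
lemma norm_one_sub_inner_le (x w : CH n) :
    ‖1 - inner ℂ (x : EuclideanSpace ℂ (Fin n)) w‖ ≤ 2 := by
  have h := norm_inner_le_norm (𝕜 := ℂ) (x : EuclideanSpace ℂ (Fin n)) w
  have hm : ‖(x : EuclideanSpace ℂ (Fin n))‖ * ‖(w : EuclideanSpace ℂ (Fin n))‖ ≤ 1 :=
    mul_le_one₀ x.norm_lt.le (norm_nonneg _) w.norm_lt.le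
  have := norm_sub_le (1 : ℂ) (inner ℂ (x : EuclideanSpace ℂ (Fin n)) w)
  rw [norm_one] at this
  linarith

lemma le_norm_one_sub_inner (x w : CH n) :
    1 - ‖(w : EuclideanSpace ℂ (Fin n))‖ ≤ ‖1 - inner ℂ (x : EuclideanSpace ℂ (Fin n)) w‖ := by
  have h := norm_inner_le_norm (𝕜 := ℂ) (x : EuclideanSpace ℂ (Fin n)) w
  have hm : ‖(x : EuclideanSpace ℂ (Fin n))‖ * ‖(w : EuclideanSpace ℂ (Fin n))‖
      ≤ ‖(w : EuclideanSpace ℂ (Fin n))‖ := mul_le_of_le_one_left (norm_nonneg _) x.norm_lt.le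
  have := norm_sub_norm_le (1 : ℂ) (inner ℂ (x : EuclideanSpace ℂ (Fin n)) w)
  rw [norm_one] at this
  linarith

/-- A multiple of `(1 - ‖x‖²)^c` has finite integral if a larger function has. -/
lemma lintegral_one_sub_norm_sq_rpow_lt_top_of_le {c K : ℝ} (hK : 0 < K) {f : CH n → ℝ≥0∞}
    (hf : ∀ x : CH n,
      ENNReal.ofReal (K * (1 - ‖(x : EuclideanSpace ℂ (Fin n))‖ ^ 2) ^ c) ≤ f x)
    (h : ∫⁻ x, f x ∂(riemannianVolume (hypMetric n)) < ⊤) :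
    ∫⁻ x : CH n, ENNReal.ofReal ((1 - ‖(x : EuclideanSpace ℂ (Fin n))‖ ^ 2) ^ c)
      ∂(riemannianVolume (hypMetric n)) < ⊤ := by
  have h2 := (lintegral_mono hf).trans_lt h
  simp_rw [ENNReal.ofReal_mul hK.le] at h2
  rw [lintegral_const_mul' _ _ ENNReal.ofReal_ne_top] at h2
  exact ENNReal.lt_top_of_mul_ne_top_right h2.ne (by simpa using hK)

lemma mem_diastaticExponents_hypMetric (w : CH n) {c : ℝ} (hc : n < c) :
    c ∈ diastaticExponents (hypMetric n) (hypDiastasis n) w := by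
  have hc0 : 0 < c := lt_of_le_of_lt n.cast_nonneg hc
  refine ⟨hc0, ?_⟩
  have hw := one_sub_norm_sq_pos w.norm_lt
  have hw1 : 0 < 1 - ‖(w : EuclideanSpace ℂ (Fin n))‖ := sub_pos.2 w.norm_lt
  set K := ((1 - ‖(w : EuclideanSpace ℂ (Fin n))‖ ^ 2)
    / (1 - ‖(w : EuclideanSpace ℂ (Fin n))‖) ^ 2) ^ c
  have bound : ∀ x, ENNReal.ofReal (Real.exp (-(c * hypDiastasis n x w))) ≤
      ENNReal.ofReal K
        * ENNReal.ofReal ((1 - ‖(x : EuclideanSpace ℂ (Fin n))‖ ^ 2) ^ c) := by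
    intro x
    have hx := one_sub_norm_sq_pos x.norm_lt
    rw [← ENNReal.ofReal_mul (by positivity), exp_neg_mul_hypDiastasis]
    refine ENNReal.ofReal_le_ofReal (mul_le_mul_of_nonneg_right
      (Real.rpow_le_rpow (by positivity) ?_ hc0.le) (by positivity))
    gcongr
    exact le_norm_one_sub_inner x w
  refine (lintegral_mono bound).trans_lt ?_
  rw [lintegral_const_mul' _ _ ENNReal.ofReal_ne_top]
  exact ENNReal.mul_lt_top ENNReal.ofReal_lt_top (lintegral_one_sub_norm_sq_rpow_lt_top hc)

lemma le_of_mem_diastaticExponents_hypMetric (w : CH n) {c : ℝ}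
    (hc : c ∈ diastaticExponents (hypMetric n) (hypDiastasis n) w) : n ≤ c := by
  have hw := one_sub_norm_sq_pos w.norm_lt
  have hc0 := hc.1
  refine le_of_lintegral_one_sub_norm_sq_rpow_lt_top hc0.le
    (lintegral_one_sub_norm_sq_rpow_lt_top_of_le
      (K := ((1 - ‖(w : EuclideanSpace ℂ (Fin n))‖ ^ 2) / 2 ^ 2) ^ c) (by positivity)
      (fun x => ?_) hc.2)
  have hx := one_sub_norm_sq_pos x.norm_lt
  have hi : 0 < ‖1 - inner ℂ (x : EuclideanSpace ℂ (Fin n)) w‖ :=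
    norm_pos_iff.2 (one_sub_inner_ne_zero x.norm_lt w.norm_lt)
  rw [exp_neg_mul_hypDiastasis]
  gcongr
  exact norm_one_sub_inner_le x w

lemma iInf_diastaticExponents_hypMetric (w : CH n) :
    ⨅ c ∈ diastaticExponents (hypMetric n) (hypDiastasis n) w, ENNReal.ofReal c = n := by
  refine le_antisymm (ENNReal.le_of_forall_pos_le_add fun ε hε _ => ?_) (le_iInf₂ fun c hc => ?_)
  · refine (iInf₂_le (n + ε : ℝ) (mem_diastaticExponents_hypMetric w (by simpa using hε))).trans ?_
    rw [ENNReal.ofReal_add n.cast_nonneg ε.coe_nonneg, ENNReal.ofReal_natCast,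
      ENNReal.ofReal_coe_nnreal]
  · rw [← ENNReal.ofReal_natCast]
    exact ENNReal.ofReal_le_ofReal (le_of_mem_diastaticExponents_hypMetric w hc)

lemma diastaticEntropy_hypMetric (w : CH n) :
    diastaticEntropy (hypMetric n) (hypDiastasis n) w = 2 * (n : ℝ≥0∞) := by
  have hX : gradSup (hypMetric n) (hypDiastasis n) ≠ ⊤ :=
    ne_top_of_le_ne_top ENNReal.ofNat_ne_top (gradSup_hypDiastasis_le n)
  have hne : diastaticExponents (hypMetric n) (hypDiastasis n) w ≠ ∅ :=
    Set.Nonempty.ne_empty ⟨n + 1, mem_diastaticExponents_hypMetric w (lt_add_one _)⟩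
  rw [diastaticEntropy, if_neg (by simp [hX, hne]), iInf_diastaticExponents_hypMetric]
  -- For `n = 0` the infimum of the exponents is 0, so the value of the gradient supremum is
  -- irrelevant.
  rcases eq_or_ne n 0 with rfl | hn
  · simp
  · rw [gradSup_hypDiastasis n hn]

lemma le_of_mem_volumeExponents_hypMetric (w : CH n) {c : ℝ}
    (hc : c ∈ volumeExponents (hypMetric n) w) : 2 * (n : ℝ) ≤ c := by
  obtain ⟨K, hK⟩ := exists_geodesicDist_le w
  have hc0 := hc.1
  have h : (n : ℝ) ≤ c / 2 := by
    -- The distance bound gives `e^{-cρ} ≥ e^{-cK} (1 - ‖x‖²)^{c/2}`. Replacing `K` by `max K 0`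
    -- keeps the bound nonnegative, so that `ENNReal.ofReal` does not truncate it.
    refine le_of_lintegral_one_sub_norm_sq_rpow_lt_top (by positivity)
      (lintegral_one_sub_norm_sq_rpow_lt_top_of_le (Real.exp_pos (-(c * max K 0)))
        (fun x => ?_) hc.2)
    have hx := one_sub_norm_sq_pos x.norm_lt
    have hlog : Real.log (1 - ‖(x : EuclideanSpace ℂ (Fin n))‖ ^ 2) ≤ 0 := Real.log_nonpos hx.le
      (by linarith [sq_nonneg ‖(x : EuclideanSpace ℂ (Fin n))‖])
    have hd : geodesicDist (hypMetric n) w x ≤ ENNReal.ofReal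
        (max K 0 - Real.log (1 - ‖(x : EuclideanSpace ℂ (Fin n))‖ ^ 2) / 2) :=
      (hK x).trans (ENNReal.ofReal_le_ofReal (by linarith [le_max_left K 0]))
    lift geodesicDist (hypMetric n) w x to NNReal using ne_top_of_le_ne_top ENNReal.ofReal_ne_top hd
      with ρ
    rw [← ENNReal.ofReal_coe_nnreal, ENNReal.ofReal_le_ofReal_iff
      (by linarith [le_max_right K 0])] at hd
    rw [← ENNReal.ofReal_coe_nnreal, EReal.coe_ennreal_ofReal,
      max_eq_left (NNReal.coe_nonneg ρ), ← EReal.coe_mul, ← EReal.coe_neg, EReal.exp_coe,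
      Real.rpow_def_of_pos hx, ← Real.exp_add]
    refine ENNReal.ofReal_le_ofReal (Real.exp_le_exp.2 ?_)
    have := mul_le_mul_of_nonneg_left hd hc0.le
    linarith
  linarith

lemma volumeEntropy_hypMetric (w : CH n) :
    volumeEntropy (hypMetric n) w = 2 * (n : ℝ≥0∞) := by
  refine le_antisymm ?_ (le_iInf₂ fun c hc => ?_)
  · rw [← diastaticEntropy_hypMetric w]
    -- The upper bound needs no distance computation: it is the general inequality, valid without a
    -- compact quotient.
    exact volumeEntropy_le_diastaticEntropy (isPosDef_hypMetric n)
      ((isGlobalDiastasis_hypDiastasis n).contMDiff_left w) w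
  · rw [← ENNReal.ofReal_natCast, ← ENNReal.ofReal_ofNat, ← ENNReal.ofReal_mul zero_le_two]
    exact ENNReal.ofReal_le_ofReal (le_of_mem_volumeExponents_hypMetric w hc)

end Entropy

end Diastatic

end

theorem lemma3p2 (n : ℕ) :
    -- the lower bound, for a compact Kähler manifold `(Y, g)` with universal covering `π`
    (∀ (Y : Type*) [TopologicalSpace Y] [T2Space Y] [CompactSpace Y] [ConnectedSpace Y]
        [ChartedSpace (EuclideanSpace ℂ (Fin n)) Y]
        [IsManifold 𝓘(ℂ, EuclideanSpace ℂ (Fin n)) ω Y]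
        (g : Diastatic.MetricTensor (EuclideanSpace ℂ (Fin n)) Y)
        (M : Type*) [TopologicalSpace M] [T2Space M] [SecondCountableTopology M]
        [ChartedSpace (EuclideanSpace ℂ (Fin n)) M]
        [IsManifold 𝓘(ℂ, EuclideanSpace ℂ (Fin n)) ω M]
        [MeasurableSpace M] [BorelSpace M]
        (π : M → Y) (D : M → M → ℝ),
        Diastatic.IsKahlerMetric g →
        Diastatic.IsUniversalCovering (EuclideanSpace ℂ (Fin n)) π →
        Diastatic.IsGlobalDiastasis (Diastatic.pullbackMetric g π) D →
        ∀ w w' : M,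
          Diastatic.volumeEntropy (Diastatic.pullbackMetric g π) w' ≤
            Diastatic.diastaticEntropy (Diastatic.pullbackMetric g π) D w) ∧
    -- the values for complex hyperbolic space
    (Diastatic.IsGlobalDiastasis (Diastatic.hypMetric n) (Diastatic.hypDiastasis n) ∧
      (∀ w : Diastatic.CH n,
        Diastatic.diastaticEntropy (Diastatic.hypMetric n) (Diastatic.hypDiastasis n) w
          = 2 * (n : ℝ≥0∞)) ∧
      ∀ w : Diastatic.CH n, Diastatic.volumeEntropy (Diastatic.hypMetric n) w
          = 2 * (n : ℝ≥0∞)) ∧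
    -- the equality for the compact quotients of complex hyperbolic space
    (∀ (X : Type*) [TopologicalSpace X] [T2Space X] [CompactSpace X] [ConnectedSpace X]
        [ChartedSpace (EuclideanSpace ℂ (Fin n)) X]
        [IsManifold 𝓘(ℂ, EuclideanSpace ℂ (Fin n)) ω X]
        (g : Diastatic.MetricTensor (EuclideanSpace ℂ (Fin n)) X)
        (π : Diastatic.CH n → X),
        Diastatic.IsKahlerMetric g →
        Diastatic.IsUniversalCovering (EuclideanSpace ℂ (Fin n)) π →
        Diastatic.pullbackMetric g π = Diastatic.hypMetric n →
        Diastatic.IsGlobalDiastasis (Diastatic.pullbackMetric g π) (Diastatic.hypDiastasis n) ∧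
        ∀ w w' : Diastatic.CH n,
          Diastatic.diastaticEntropy (Diastatic.pullbackMetric g π)
              (Diastatic.hypDiastasis n) w = 2 * (n : ℝ≥0∞) ∧
          Diastatic.volumeEntropy (Diastatic.pullbackMetric g π) w' = 2 * (n : ℝ≥0∞)) := by
  refine ⟨?_, ⟨Diastatic.isGlobalDiastasis_hypDiastasis n, Diastatic.diastaticEntropy_hypMetric,
    Diastatic.volumeEntropy_hypMetric⟩, ?_⟩
  · intro Y _ _ _ _ _ _ g M _ _ _ _ _ _ _ π D hg hπ hD w w'
    exact Diastatic.volumeEntropy_le_diastaticEntropy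
      (hg.isPosDef_pullbackMetric hπ.locallyBiholomorphic) (hD.contMDiff_left w) w'
  · intro X _ _ _ _ _ _ g π _ _ hpull
    rw [hpull]
    exact ⟨Diastatic.isGlobalDiastasis_hypDiastasis n, fun w w' =>
      ⟨Diastatic.diastaticEntropy_hypMetric w, Diastatic.volumeEntropy_hypMetric w'⟩⟩
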